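/- Let $3<p<\infty$ and let $M:[0,\infty)\to[0,\infty)$, $M(t)=t^pe^{t-1}$ (with $M(0)=0$). Let $\ell_M$ be the associated real Orlicz sequence space, i.e. the space of all $x=(x_n)_{n\in\mathbb N}\in\mathbb R^{\mathbb N}$ for which $\{\rho>0 : \sum_n M(|x_n|/\rho)\le 1\}$ is nonempty, equipped with the Luxemburg norm $$\|x\|_M=\inf\Big\{\rho>0 : \sum_n M(|x_n|/\rho)\le 1\Big\}.$$ Then $X=\ell_M$ is a separable Banach space with the following properties, where $\mathrm{Iso}(X)$ denotes the group of surjective linear isometries of $X$. 1. $X$ is guarded Fraïssé: for every finite-dimensional subspace $E\subseteq X$ and every $\varepsilon>0$ there exist $\delta>0$ and a finite-dimensional subspace $F\subseteq X$ with $E\subseteq F$ such that $\mathrm{Iso}(X)$ acts $\varepsilon$-transitively on $\{T|_E : T\in\mathrm{Emb}_{1+\delta}(F,X)\}$. Here $\mathrm{Emb}_C(F,X)$ is the set of linear injections $T:F\to X$ with $\max(\|T\|,\|T^{-1}\|)\le C$ (with $T^{-1}$ defined on $T(F)$), $\mathrm{Iso}(X)$ acts by composition, and a group $G$ acts $\varepsilon$-transitively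 on a set $S$ of operators if $\inf_{g\in G}\|y-gx\|\le\varepsilon$ for all $x,y\in S$. 2. $X$ is not oligomorphic ($\omega$-categorical), that is, it is not true that for every $n\in\mathbb N$ the metric quotient of $(\mathrm{Ball}_X)^n$ by the diagonal action of $\mathrm{Iso}(X)$ is compact. Here $\mathrm{Ball}_X$ is the closed unit ball, and the metric quotient is the set of closures of orbits with the distance $d(\overline{Gx},\overline{Gy})=\inf_{g\in G}d(gx,y)$, $G=\mathrm{Iso}(X)$. 3. $X$ contains no isometric copy, and not even an isomorphic copy, of the real Hilbert space $\ell_2$. 4. The age of $X$ is not closed. Here, for $n\in\mathbb N$, $\mathrm{BM}_n$ is the set of $n$-dimensional real Banach spaces up to isometry, with the Banach–Mazur distance $\inf\{\log(\|T\|\,\|T^{-1}\|) : T:E\to F \text{ an isomorphism}\}$, $\mathrm{BM}=\bigsqcup_n\mathrm{BM}_n$ carries the disjoint union topology, and the age of $X$ is the set of those classes in $\mathrm{BM}$ whose members embed linearly and isometrically into $X$. -/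

import Mathlib

open scoped ENNReal

noncomputable section

/-! ## Orlicz functions and Orlicz sequence spaces -/

/-- An Orlicz function: a convex function `M : [0, ∞) → [0, ∞)` with `M 0 = 0` and `M t → ∞` as
`t → ∞`.  It is represented by a function on `ℝ`, of which only the values on `[0, ∞)` matter. -/
structure OrliczFunction where
  toFun : ℝ → ℝ
  nonneg' : ∀ t, 0 ≤ t → 0 ≤ toFun t
  zero' : toFun 0 = 0
  convex' : ConvexOn ℝ (Set.Ici 0) toFun
  tendsto' : Filter.Tendsto toFun Filter.atTop Filter.atTop

namespace OrliczFunction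

instance : CoeFun OrliczFunction (fun _ => ℝ → ℝ) := ⟨OrliczFunction.toFun⟩

variable (M : OrliczFunction)

theorem mono {s t : ℝ} (hs : 0 ≤ s) (hst : s ≤ t) : M s ≤ M t := by
  rcases hs.eq_or_lt with rfl | hs'
  · rw [show M 0 = 0 from M.zero']
    exact M.nonneg' t hst
  · have ht : 0 < t := hs'.trans_le hst
    have hr : s / t ≤ 1 := (div_le_one ht).2 hst
    have h := M.convex'.2 (Set.mem_Ici.2 ht.le) (Set.mem_Ici.2 (le_refl (0 : ℝ)))
      (show 0 ≤ s / t by positivity) (show 0 ≤ 1 - s / t by linarith) (by ring)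
    simp only [smul_eq_mul, mul_zero, add_zero, M.zero'] at h
    rw [div_mul_cancel₀ _ ht.ne'] at h
    refine h.trans ?_
    have := M.nonneg' t ht.le
    nlinarith

/-- The set of all `ρ > 0` such that `∑ₙ M (|x n| / ρ) ≤ 1`. -/
def luxSet (x : ℕ → ℝ) : Set ℝ :=
  {ρ | 0 < ρ ∧ ∑' n, ENNReal.ofReal (M (|x n| / ρ)) ≤ 1}

theorem luxSet_upward {x : ℕ → ℝ} {ρ σ : ℝ} (h : ρ ∈ M.luxSet x) (hρσ : ρ ≤ σ) :
    σ ∈ M.luxSet x := by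
  refine ⟨h.1.trans_le hρσ, le_trans (ENNReal.tsum_le_tsum fun n => ?_) h.2⟩
  refine ENNReal.ofReal_le_ofReal (M.mono ?_ ?_)
  · exact div_nonneg (abs_nonneg _) (h.1.trans_le hρσ).le
  · exact div_le_div_of_nonneg_left (abs_nonneg _) h.1 hρσ

theorem mem_luxSet_zero {ρ : ℝ} (h : 0 < ρ) : ρ ∈ M.luxSet 0 := by
  refine ⟨h, ?_⟩
  simp [M.zero']

theorem add_mem_luxSet {x y : ℕ → ℝ} {ρ σ : ℝ} (hx : ρ ∈ M.luxSet x) (hy : σ ∈ M.luxSet y) :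
    ρ + σ ∈ M.luxSet (x + y) := by
  have hρ := hx.1
  have hσ := hy.1
  have hs : 0 < ρ + σ := add_pos hρ hσ
  refine ⟨hs, ?_⟩
  set a : ℝ := ρ / (ρ + σ) with ha
  set b : ℝ := σ / (ρ + σ) with hb
  have ha0 : 0 ≤ a := by positivity
  have hb0 : 0 ≤ b := by positivity
  have hab : a + b = 1 := by rw [ha, hb]; field_simp
  have key : ∀ n, ENNReal.ofReal (M (|(x + y) n| / (ρ + σ))) ≤
      ENNReal.ofReal a * ENNReal.ofReal (M (|x n| / ρ)) +
        ENNReal.ofReal b * ENNReal.ofReal (M (|y n| / σ)) := by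
    intro n
    have h1 : 0 ≤ |x n| / ρ := by positivity
    have h2 : 0 ≤ |y n| / σ := by positivity
    rw [← ENNReal.ofReal_mul ha0, ← ENNReal.ofReal_mul hb0,
      ← ENNReal.ofReal_add (mul_nonneg ha0 (M.nonneg' _ h1)) (mul_nonneg hb0 (M.nonneg' _ h2))]
    refine ENNReal.ofReal_le_ofReal ?_
    have hc := M.convex'.2 (Set.mem_Ici.2 h1) (Set.mem_Ici.2 h2) ha0 hb0 hab
    simp only [smul_eq_mul] at hc
    refine (M.mono (by positivity) ?_).trans hc
    have e : a * (|x n| / ρ) + b * (|y n| / σ) = (|x n| + |y n|) / (ρ + σ) := by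
      rw [ha, hb]; field_simp
    rw [e]
    exact div_le_div_of_nonneg_right (abs_add_le _ _) hs.le
  calc ∑' n, ENNReal.ofReal (M (|(x + y) n| / (ρ + σ)))
      ≤ ∑' n, (ENNReal.ofReal a * ENNReal.ofReal (M (|x n| / ρ)) +
        ENNReal.ofReal b * ENNReal.ofReal (M (|y n| / σ))) := ENNReal.tsum_le_tsum key
    _ = ENNReal.ofReal a * ∑' n, ENNReal.ofReal (M (|x n| / ρ)) +
        ENNReal.ofReal b * ∑' n, ENNReal.ofReal (M (|y n| / σ)) := by
        rw [ENNReal.tsum_add, ENNReal.tsum_mul_left, ENNReal.tsum_mul_left]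
    _ ≤ ENNReal.ofReal a * 1 + ENNReal.ofReal b * 1 := by
        gcongr
        · exact hx.2
        · exact hy.2
    _ = 1 := by rw [mul_one, mul_one, ← ENNReal.ofReal_add ha0 hb0, hab, ENNReal.ofReal_one]

theorem smul_mem_luxSet {x : ℕ → ℝ} {ρ c : ℝ} (hc : c ≠ 0) (hx : ρ ∈ M.luxSet x) :
    |c| * ρ ∈ M.luxSet (c • x) := by
  have hc' : 0 < |c| := abs_pos.2 hc
  refine ⟨mul_pos hc' hx.1, ?_⟩
  have : ∀ n, |(c • x) n| / (|c| * ρ) = |x n| / ρ := by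
    intro n
    rw [Pi.smul_apply, smul_eq_mul, abs_mul, mul_div_mul_left _ _ hc'.ne']
  simp only [this]
  exact hx.2

/-- The Luxemburg norm `inf {ρ > 0 | ∑ₙ M (|x n| / ρ) ≤ 1}`; it is used only for sequences for which
the set is nonempty. -/
def luxNorm (x : ℕ → ℝ) : ℝ := sInf (M.luxSet x)

theorem luxSet_bddBelow (x : ℕ → ℝ) : BddBelow (M.luxSet x) := ⟨0, fun _ h => h.1.le⟩

theorem luxNorm_nonneg (x : ℕ → ℝ) : 0 ≤ M.luxNorm x := Real.sInf_nonneg fun _ h => h.1.le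

theorem luxNorm_le {x : ℕ → ℝ} {ρ : ℝ} (h : ρ ∈ M.luxSet x) : M.luxNorm x ≤ ρ :=
  csInf_le (M.luxSet_bddBelow x) h

theorem mem_luxSet_of_lt {x : ℕ → ℝ} (hx : (M.luxSet x).Nonempty) {ρ : ℝ}
    (h : M.luxNorm x < ρ) : ρ ∈ M.luxSet x := by
  obtain ⟨σ, hσ, hlt⟩ := exists_lt_of_csInf_lt hx h
  exact M.luxSet_upward hσ hlt.le

theorem luxNorm_add_le {x y : ℕ → ℝ} (hx : (M.luxSet x).Nonempty) (hy : (M.luxSet y).Nonempty) :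
    M.luxNorm (x + y) ≤ M.luxNorm x + M.luxNorm y := by
  refine le_of_forall_pos_le_add fun ε hε => ?_
  have h1 := M.mem_luxSet_of_lt hx (ρ := M.luxNorm x + ε / 2) (by linarith)
  have h2 := M.mem_luxSet_of_lt hy (ρ := M.luxNorm y + ε / 2) (by linarith)
  have := M.luxNorm_le (M.add_mem_luxSet h1 h2)
  linarith

theorem luxNorm_zero : M.luxNorm 0 = 0 := by
  refine le_antisymm (le_of_forall_pos_le_add fun ε hε => ?_) (M.luxNorm_nonneg 0)
  rw [zero_add]
  exact M.luxNorm_le (M.mem_luxSet_zero hε)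

theorem luxNorm_smul_le (c : ℝ) {x : ℕ → ℝ} (hx : (M.luxSet x).Nonempty) :
    M.luxNorm (c • x) ≤ |c| * M.luxNorm x := by
  rcases eq_or_ne c 0 with rfl | hc
  · rw [zero_smul, luxNorm_zero, abs_zero, zero_mul]
  · have hc' : 0 < |c| := abs_pos.2 hc
    refine le_of_forall_pos_le_add fun ε hε => ?_
    have h := M.mem_luxSet_of_lt hx (ρ := M.luxNorm x + ε / |c|)
      (by have := div_pos hε hc'; linarith)
    have := M.luxNorm_le (M.smul_mem_luxSet hc h)
    rwa [mul_add, mul_div_cancel₀ _ hc'.ne'] at this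

theorem luxNorm_smul (c : ℝ) {x : ℕ → ℝ} (hx : (M.luxSet x).Nonempty) :
    M.luxNorm (c • x) = |c| * M.luxNorm x := by
  refine le_antisymm (M.luxNorm_smul_le c hx) ?_
  rcases eq_or_ne c 0 with rfl | hc
  · rw [abs_zero, zero_mul]
    exact M.luxNorm_nonneg _
  · have hc' : 0 < |c| := abs_pos.2 hc
    obtain ⟨ρ, hρ⟩ := hx
    have h := M.luxNorm_smul_le c⁻¹ (x := c • x) ⟨_, M.smul_mem_luxSet hc hρ⟩
    rw [smul_smul, inv_mul_cancel₀ hc, one_smul, abs_inv] at h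
    calc |c| * M.luxNorm x ≤ |c| * (|c|⁻¹ * M.luxNorm (c • x)) := by gcongr
      _ = M.luxNorm (c • x) := by field_simp

theorem eq_zero_of_luxNorm {x : ℕ → ℝ} (hx : (M.luxSet x).Nonempty) (h : M.luxNorm x = 0) :
    x = 0 := by
  by_contra hne
  obtain ⟨n, hn⟩ := Function.ne_iff.1 hne
  have hn' : 0 < |x n| := abs_pos.2 hn
  obtain ⟨t, ht1, ht0⟩ := ((M.tendsto'.eventually_gt_atTop 1).and
    (Filter.eventually_gt_atTop (0 : ℝ))).exists
  have hm := M.mem_luxSet_of_lt hx (ρ := |x n| / t) (by rw [h]; positivity)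
  have h1 := (ENNReal.le_tsum n).trans hm.2
  rw [div_div_cancel₀ hn'.ne', ENNReal.ofReal_le_one] at h1
  exact absurd h1 (not_le.2 ht1)

/-- The vector space of all real sequences whose Luxemburg norm is finite. -/
def seqSubmodule : Submodule ℝ (ℕ → ℝ) where
  carrier := {x | (M.luxSet x).Nonempty}
  zero_mem' := ⟨1, M.mem_luxSet_zero one_pos⟩
  add_mem' := fun ⟨_, hx⟩ ⟨_, hy⟩ => ⟨_, M.add_mem_luxSet hx hy⟩
  smul_mem' := by
    rintro c x ⟨ρ, hx⟩
    rcases eq_or_ne c 0 with rfl | hc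
    · rw [zero_smul]
      exact ⟨1, M.mem_luxSet_zero one_pos⟩
    · exact ⟨_, M.smul_mem_luxSet hc hx⟩

end OrliczFunction

/-- The Orlicz sequence space `ℓ_M` (real scalars).  This is a type synonym, so that the topology is
that of the Luxemburg norm and not the product topology. -/
def OrliczSeq (M : OrliczFunction) : Type := M.seqSubmodule

namespace OrliczSeq

variable (M : OrliczFunction)

instance : AddCommGroup (OrliczSeq M) := inferInstanceAs (AddCommGroup M.seqSubmodule)

instance : Module ℝ (OrliczSeq M) := inferInstanceAs (Module ℝ M.seqSubmodule)

instance : CoeFun (OrliczSeq M) (fun _ => ℕ → ℝ) := ⟨fun x => x.1⟩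

instance : Norm (OrliczSeq M) := ⟨fun x => M.luxNorm x⟩

theorem normCore : NormedSpace.Core ℝ (OrliczSeq M) where
  norm_nonneg x := M.luxNorm_nonneg x
  norm_smul c x := M.luxNorm_smul c x.2
  norm_triangle x y := M.luxNorm_add_le x.2 y.2
  norm_eq_zero_iff x :=
    ⟨fun h => Subtype.ext (M.eq_zero_of_luxNorm x.2 h), fun h => h ▸ M.luxNorm_zero⟩

instance : NormedAddCommGroup (OrliczSeq M) := NormedAddCommGroup.ofCore (normCore M)

instance : NormedSpace ℝ (OrliczSeq M) := NormedSpace.ofCore (normCore M)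

end OrliczSeq

/-- The Orlicz function `M t = t ^ p * e ^ (t - 1)`, for `3 < p < ∞`. -/
def expOrlicz (p : ℝ) (hp : 3 < p) : OrliczFunction where
  toFun t := t ^ p * Real.exp (t - 1)
  nonneg' t ht := mul_nonneg (Real.rpow_nonneg ht p) (Real.exp_pos _).le
  zero' := by rw [Real.zero_rpow (by linarith), zero_mul]
  convex' := by
    have hexp : ConvexOn ℝ (Set.Ici 0) (fun t : ℝ => Real.exp (t - 1)) := by
      have h : ConvexOn ℝ (Set.Ici 0) (fun t : ℝ => Real.exp (-1) • Real.exp t) :=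
        (convexOn_exp.subset (Set.subset_univ _) (convex_Ici 0)).smul (Real.exp_pos (-1)).le
      refine h.congr fun t _ => ?_
      simp only [smul_eq_mul]
      rw [← Real.exp_add]
      ring_nf
    refine ConvexOn.mul (convexOn_rpow (by linarith)) hexp
      (fun t ht => Real.rpow_nonneg ht p) (fun t _ => (Real.exp_pos _).le) ?_
    refine MonotoneOn.monovaryOn ?_ ?_
    · intro s hs t _ hst
      exact Real.rpow_le_rpow hs hst (by linarith)
    · intro s _ t _ hst
      exact Real.exp_le_exp.2 (by linarith)
  tendsto' := by
    refine (tendsto_rpow_atTop (by linarith : 0 < p)).atTop_mul_atTop₀ ?_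
    exact Real.tendsto_exp_atTop.comp (Filter.tendsto_atTop_add_const_right _ (-1) Filter.tendsto_id)

/-! ## The isometry group `Iso(X)`, which is `X ≃ₗᵢ[ℝ] X`, and its actions -/

section Iso

variable {X : Type*} [NormedAddCommGroup X] [NormedSpace ℝ X]

instance isoDistribMulAction : DistribMulAction (X ≃ₗᵢ[ℝ] X) X where
  smul U x := U x
  one_smul _ := rfl
  mul_smul _ _ _ := rfl
  smul_zero U := U.map_zero
  smul_add U := U.map_add

theorem iso_smul_def (U : X ≃ₗᵢ[ℝ] X) (x : X) : U • x = U x := rfl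

instance isoSMulCommClass : SMulCommClass ℝ (X ≃ₗᵢ[ℝ] X) X where
  smul_comm c U x := (U.map_smul c x).symm

instance isoIsIsometricSMul : IsIsometricSMul (X ≃ₗᵢ[ℝ] X) X := ⟨fun U => U.isometry⟩

/-- The action of `Iso(X)` on the closed unit ball of `X`. -/
instance isoMulActionBall :
    MulAction (X ≃ₗᵢ[ℝ] X) (Metric.closedBall (0 : X) 1) where
  smul U x := ⟨U x, by
    have := x.2
    rw [mem_closedBall_zero_iff] at this ⊢
    rwa [U.norm_map]⟩
  one_smul _ := rfl
  mul_smul _ _ _ := rfl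

theorem iso_smul_ball_coe (U : X ≃ₗᵢ[ℝ] X) (x : Metric.closedBall (0 : X) 1) :
    ((U • x : Metric.closedBall (0 : X) 1) : X) = U x := rfl

instance isoIsIsometricSMulBall :
    IsIsometricSMul (X ≃ₗᵢ[ℝ] X) (Metric.closedBall (0 : X) 1) :=
  ⟨fun U => Isometry.of_dist_eq fun x y => U.isometry.dist_eq (x : X) y⟩

end Iso

/-! ## Guarded Fraïssé spaces -/

/-- `G` acts `ε`-transitively on the subset `S` of a metric space: `d(y, G x) ≤ ε` for all
`x, y ∈ S`. -/
def ActsEpsTransitivelyOn (G : Type*) {A : Type*} [Group G] [PseudoMetricSpace A] [MulAction G A]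
    (ε : ℝ) (S : Set A) : Prop :=
  ∀ x ∈ S, ∀ y ∈ S, Metric.infDist y (MulAction.orbit G x) ≤ ε

section Fraisse

variable {X : Type*} [NormedAddCommGroup X] [NormedSpace ℝ X]

/-- `Emb_C(E, X)`: the linear injections `T : E → X` with `‖T‖ ≤ C` and `‖T⁻¹‖ ≤ C`, where `T⁻¹` is
defined on the range of `T`; the last bound says that `‖x‖ ≤ C * ‖T x‖` for all `x`. -/
def EmbC (C : ℝ) (E : Submodule ℝ X) : Set (E →L[ℝ] X) :=
  {T | Function.Injective T ∧ ‖T‖ ≤ C ∧ ∀ x : E, ‖x‖ ≤ C * ‖T x‖}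

/-- The restriction to `E` of an operator that is defined on a subspace `F ⊇ E`. -/
def restrictTo {E F : Submodule ℝ X} (h : E ≤ F) (T : F →L[ℝ] X) : E →L[ℝ] X :=
  T.comp (E.subtypeL.codRestrict F fun x => h x.2)

variable (X)

/-- The guarded Fraïssé property. The isometry group acts on operators by composition. -/
def IsGuardedFraisse : Prop :=
  ∀ E : Submodule ℝ X, FiniteDimensional ℝ E → ∀ ε : ℝ, 0 < ε →
    ∃ δ : ℝ, 0 < δ ∧ ∃ F : Submodule ℝ X, FiniteDimensional ℝ F ∧ ∃ h : E ≤ F,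
      ActsEpsTransitivelyOn (X ≃ₗᵢ[ℝ] X) ε (restrictTo h '' EmbC (1 + δ) F)

end Fraisse

/-! ## Metric quotients and oligomorphic spaces -/

/-- The set `A`, to be equipped with the pseudometric `d(G x, y)`. -/
def OrbitPseudo (_G A : Type*) : Type _ := A

namespace OrbitPseudo

variable (G A : Type*) [Group G] [PseudoMetricSpace A] [MulAction G A] [IsIsometricSMul G A]

/-- The distance `d(G x, y) = inf_g d(g x, y)`. -/
instance : PseudoMetricSpace (OrbitPseudo G A) where
  dist x y := ⨅ g : G, dist (g • (show A from x)) (show A from y)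
  dist_self x := by
    refine le_antisymm ?_ (Real.iInf_nonneg fun _ => dist_nonneg)
    refine (ciInf_le ⟨0, ?_⟩ (1 : G)).trans ?_
    · rintro _ ⟨g, rfl⟩
      exact dist_nonneg
    · rw [one_smul, dist_self]
  dist_comm x y := by
    refine (Equiv.iInf_congr (Equiv.inv G) fun g => ?_)
    change dist (g⁻¹ • (show A from y)) (show A from x) = dist (g • (show A from x)) (show A from y)
    rw [← dist_smul g, smul_inv_smul, dist_comm]
  dist_triangle x y z := by
    refine le_ciInf_add_ciInf fun g h => ?_
    refine (ciInf_le ⟨0, ?_⟩ (h * g)).trans ?_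
    · rintro _ ⟨k, rfl⟩
      exact dist_nonneg
    · refine (dist_triangle _ (h • (show A from y)) _).trans ?_
      rw [mul_smul, dist_smul]

theorem dist_def (x y : A) :
    dist (show OrbitPseudo G A from x) (show OrbitPseudo G A from y) = ⨅ g : G, dist (g • x) y :=
  rfl

end OrbitPseudo

/-- The metric quotient of the metric space `A` by an isometric action of `G`: the set of closures of
orbits, with the metric induced by `d(G x, y)`.  Two points have the same orbit closure exactly when
`d(G x, y) = 0`. -/
abbrev MetricQuotient (G A : Type*) [Group G] [PseudoMetricSpace A] [MulAction G A]
    [IsIsometricSMul G A] : Type _ :=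
  SeparationQuotient (OrbitPseudo G A)

/-- `X` is oligomorphic: for every `n`, the metric quotient of the `n`-th power of the closed unit
ball of `X` by the diagonal action of the isometry group is compact. -/
def IsOligomorphic (X : Type*) [NormedAddCommGroup X] [NormedSpace ℝ X] : Prop :=
  ∀ n : ℕ, CompactSpace (MetricQuotient (X ≃ₗᵢ[ℝ] X) (Fin n → Metric.closedBall (0 : X) 1))

/-! ## The Banach-Mazur compactum and the age -/

/-- A real normed space of dimension `n` (it is automatically complete). -/
structure NormedSpaceOfDim (n : ℕ) where
  carrier : Type
  [group : NormedAddCommGroup carrier]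
  [space : NormedSpace ℝ carrier]
  [finite : FiniteDimensional ℝ carrier]
  finrank_eq : Module.finrank ℝ carrier = n

attribute [instance] NormedSpaceOfDim.group NormedSpaceOfDim.space NormedSpaceOfDim.finite

namespace NormedSpaceOfDim

variable {n : ℕ}

instance : CoeSort (NormedSpaceOfDim n) Type := ⟨NormedSpaceOfDim.carrier⟩

/-- The quantity `log (‖T‖ * ‖T⁻¹‖)` of an isomorphism `T`. -/
def logDistortion {E F : NormedSpaceOfDim n} (T : E ≃L[ℝ] F) : ℝ :=
  Real.log (‖(T : E →L[ℝ] F)‖ * ‖(T.symm : F →L[ℝ] E)‖)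

theorem exists_equiv (E F : NormedSpaceOfDim n) : Nonempty (E ≃L[ℝ] F) :=
  FiniteDimensional.nonempty_continuousLinearEquiv_of_finrank_eq
    (E.finrank_eq.trans F.finrank_eq.symm)

instance (E F : NormedSpaceOfDim n) : Nonempty (E ≃L[ℝ] F) := exists_equiv E F

theorem logDistortion_nonneg {E F : NormedSpaceOfDim n} (T : E ≃L[ℝ] F) : 0 ≤ logDistortion T := by
  rcases subsingleton_or_nontrivial E with h | h
  · have : (T : E →L[ℝ] F) = 0 := by
      ext x
      rw [Subsingleton.elim x 0, map_zero, map_zero]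
    rw [logDistortion, this, norm_zero, zero_mul, Real.log_zero]
  · exact Real.log_nonneg T.one_le_norm_mul_norm_symm

/-- The Banach-Mazur distance. -/
def bmDist (E F : NormedSpaceOfDim n) : ℝ := ⨅ T : E ≃L[ℝ] F, logDistortion T

theorem bddBelow_logDistortion (E F : NormedSpaceOfDim n) :
    BddBelow (Set.range fun T : E ≃L[ℝ] F => logDistortion T) :=
  ⟨0, by rintro _ ⟨T, rfl⟩; exact logDistortion_nonneg T⟩

theorem bmDist_nonneg (E F : NormedSpaceOfDim n) : 0 ≤ bmDist E F :=
  Real.iInf_nonneg fun T => logDistortion_nonneg T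

theorem bmDist_comm (E F : NormedSpaceOfDim n) : bmDist E F = bmDist F E := by
  have h : ∀ E F : NormedSpaceOfDim n, bmDist E F ≤ bmDist F E := by
    intro E F
    refine le_ciInf fun T => (ciInf_le (bddBelow_logDistortion E F) T.symm).trans (le_of_eq ?_)
    rw [logDistortion, logDistortion, mul_comm, ContinuousLinearEquiv.symm_symm]
  exact le_antisymm (h E F) (h F E)

/-- Isometry of normed spaces of dimension `n`. -/
def isometrySetoid (n : ℕ) : Setoid (NormedSpaceOfDim n) where
  r E F := Nonempty (E ≃ₗᵢ[ℝ] F)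
  iseqv := ⟨fun E => ⟨LinearIsometryEquiv.refl ℝ E⟩, fun ⟨T⟩ => ⟨T.symm⟩,
    fun ⟨T⟩ ⟨S⟩ => ⟨T.trans S⟩⟩

theorem bmDist_eq_zero {E F : NormedSpaceOfDim n} (h : Nonempty (E ≃ₗᵢ[ℝ] F)) :
    bmDist E F = 0 := by
  obtain ⟨T⟩ := h
  refine le_antisymm ((ciInf_le (bddBelow_logDistortion E F) T.toContinuousLinearEquiv).trans ?_)
    (bmDist_nonneg E F)
  refine Real.log_nonpos (by positivity) ?_
  refine mul_le_one₀ ?_ (norm_nonneg _) ?_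
  · exact ContinuousLinearMap.opNorm_le_bound _ zero_le_one fun x => by
      rw [one_mul]; exact (T.norm_map x).le
  · exact ContinuousLinearMap.opNorm_le_bound _ zero_le_one fun x => by
      rw [one_mul]; exact (T.symm.norm_map x).le

theorem logDistortion_trans_le {E F H : NormedSpaceOfDim n} (T : E ≃L[ℝ] F) (S : F ≃L[ℝ] H) :
    logDistortion (T.trans S) ≤ logDistortion T + logDistortion S := by
  rcases subsingleton_or_nontrivial E with h | h
  · have : ((T.trans S : E ≃L[ℝ] H) : E →L[ℝ] H) = 0 := by
      ext x
      rw [Subsingleton.elim x 0, map_zero, map_zero]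
    have h0 : logDistortion (T.trans S) = 0 := by
      rw [logDistortion, this, norm_zero, zero_mul, Real.log_zero]
    rw [h0]
    exact add_nonneg (logDistortion_nonneg T) (logDistortion_nonneg S)
  · have : Nontrivial F := T.toEquiv.symm.nontrivial
    have h1 := T.one_le_norm_mul_norm_symm
    have h2 := S.one_le_norm_mul_norm_symm
    have h3 := (T.trans S).one_le_norm_mul_norm_symm
    rw [logDistortion, logDistortion, logDistortion, ← Real.log_mul (by positivity) (by positivity)]
    refine Real.log_le_log (by positivity) ?_
    have e1 : ‖((T.trans S : E ≃L[ℝ] H) : E →L[ℝ] H)‖ ≤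
        ‖(S : F →L[ℝ] H)‖ * ‖(T : E →L[ℝ] F)‖ :=
      (S : F →L[ℝ] H).opNorm_comp_le (T : E →L[ℝ] F)
    have e2 : ‖((T.trans S).symm : H →L[ℝ] E)‖ ≤
        ‖(T.symm : F →L[ℝ] E)‖ * ‖(S.symm : H →L[ℝ] F)‖ :=
      (T.symm : F →L[ℝ] E).opNorm_comp_le (S.symm : H →L[ℝ] F)
    calc _ ≤ (‖(S : F →L[ℝ] H)‖ * ‖(T : E →L[ℝ] F)‖) *
          (‖(T.symm : F →L[ℝ] E)‖ * ‖(S.symm : H →L[ℝ] F)‖) := by gcongr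
      _ = _ := by ring

theorem bmDist_triangle (E F H : NormedSpaceOfDim n) :
    bmDist E H ≤ bmDist E F + bmDist F H := by
  refine le_ciInf_add_ciInf fun T S => ?_
  exact (ciInf_le (bddBelow_logDistortion E H) (T.trans S)).trans (logDistortion_trans_le T S)

theorem bmDist_congr {E E' F F' : NormedSpaceOfDim n} (h : Nonempty (E ≃ₗᵢ[ℝ] E'))
    (h' : Nonempty (F ≃ₗᵢ[ℝ] F')) : bmDist E F = bmDist E' F' := by
  have h0 := bmDist_eq_zero h
  have h1 := bmDist_eq_zero h'
  have h2 := bmDist_comm E E'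
  have h3 := bmDist_comm F F'
  have t1 := bmDist_triangle E E' F
  have t2 := bmDist_triangle E' F' F
  have t3 := bmDist_triangle E' E F'
  have t4 := bmDist_triangle E F F'
  linarith

end NormedSpaceOfDim

/-- `BM_n`: the set of all real normed spaces of dimension `n`, up to isometry. -/
def BMn (n : ℕ) : Type 1 := Quotient (NormedSpaceOfDim.isometrySetoid n)

/-- `BM_n` with the Banach-Mazur distance.  (This distance is in fact a metric on `BM_n`; only the
topology is used.) -/
instance (n : ℕ) : PseudoMetricSpace (BMn n) where
  dist := Quotient.lift₂ NormedSpaceOfDim.bmDist fun _ _ _ _ h h' => NormedSpaceOfDim.bmDist_congr h h'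
  dist_self := by
    rintro ⟨E⟩
    exact NormedSpaceOfDim.bmDist_eq_zero ⟨LinearIsometryEquiv.refl ℝ E⟩
  dist_comm := by
    rintro ⟨E⟩ ⟨F⟩
    exact NormedSpaceOfDim.bmDist_comm E F
  dist_triangle := by
    rintro ⟨E⟩ ⟨F⟩ ⟨H⟩
    exact NormedSpaceOfDim.bmDist_triangle E F H

/-- `BM`, the disjoint union of all `BM_n`, with the disjoint union topology. -/
abbrev BM : Type 1 := Σ n : ℕ, BMn n

/-- The class in `BM` of a normed space of dimension `n`. -/
def BM.mk {n : ℕ} (E : NormedSpaceOfDim n) : BM :=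
  ⟨n, Quotient.mk (NormedSpaceOfDim.isometrySetoid n) E⟩

/-- The age of `X`: all classes of finite-dimensional spaces that embed isometrically into `X`. -/
def age (X : Type*) [NormedAddCommGroup X] [NormedSpace ℝ X] : Set BM :=
  {c | ∃ (n : ℕ) (E : NormedSpaceOfDim n), c = BM.mk E ∧ Nonempty (E →ₗᵢ[ℝ] X)}

/-- The age of `X` is closed. -/
def HasClosedAge (X : Type*) [NormedAddCommGroup X] [NormedSpace ℝ X] : Prop :=
  IsClosed (age X)

/-! ## Copies of a space -/

/-- `X` contains an isomorphic copy of `Y`. -/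
def ContainsIsomorphicCopy (Y X : Type*) [NormedAddCommGroup Y] [NormedSpace ℝ Y]
    [NormedAddCommGroup X] [NormedSpace ℝ X] : Prop :=
  ∃ Z : Submodule ℝ X, Nonempty (Y ≃L[ℝ] Z)

/-- `X` contains an isometric copy of `Y`. -/
def ContainsIsometricCopy (Y X : Type*) [NormedAddCommGroup Y] [NormedSpace ℝ Y]
    [NormedAddCommGroup X] [NormedSpace ℝ X] : Prop :=
  ∃ Z : Submodule ℝ X, Nonempty (Y ≃ₗᵢ[ℝ] Z)

end

/-! Write `M t = t ^ p * e ^ (t - 1)`, so `M 1 = 1`, and let the modular of `x` be `∑ M |x n|`. On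
bounded sequences `M` is comparable with `t ^ p`, so the space is `ℓ_p` with an equivalent norm.
Completeness and separability follow, and so does the absence of `ℓ_2`, since `p > 2`.

The isometric structure comes from `M (s t) = s ^ p * e ^ ((s - 1) t) * M t`: for `s < 1`, scaling
by `s` costs more at large coordinates, so the norm can tell peaked vectors from flat ones. Let `M a
= 1/2`; then `‖e_i ± e_j‖ = 1/a`. If `f`, `g` have norm about one and `‖f ± g‖` is at most about
`1/a`, the Clarkson inequality bounds the sum of the modulars of `a f` and `a g` by about 1. Each is
at least about `M a = 1/2`, and that of `f` is strictly larger when all coordinates of `f` stay away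
from modulus 1. So `f` is close to a signed unit vector (`exists_near_unit`).

Hence almost isometric embeddings send unit vectors near distinct signed unit vectors
(`exists_units_near`), on which signed permutations act transitively. Guarding `E` by enough unit
vectors to approximate it gives the guarded Fraïssé property. The same rigidity keeps the orbits of
normalized flat vectors on `2 ^ j` coordinates uniformly apart, so the quotient of the unit ball is
not compact.

Near zero `M` is almost homogeneous, so two disjoint flat blocks of small height span almost an
`ℓ_p`-plane (`exists_almost_lp_plane`). An exact `ℓ_p`-plane is impossible: a second-order expansion
with `p > 3` forces disjoint supports (`disjoint_of_norm_rpow_eq`), and then the exponential factor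
makes the norm of a combination too small. So the age is not closed. -/

open Filter Topology

/-! ## The function `t ^ p * e ^ (t - 1)` and its modular -/

/-- The function `t ^ p * e ^ (t - 1)`. -/
noncomputable def expFun (p t : ℝ) : ℝ := t ^ p * Real.exp (t - 1)

/-- The modular `∑ₙ M (|x n|)` of the Orlicz function `M t = t ^ p * e ^ (t - 1)`. -/
noncomputable def modular (p : ℝ) (x : ℕ → ℝ) : ℝ := ∑' n, expFun p |x n|

section expFun

variable {p : ℝ}

theorem expFun_nonneg {t : ℝ} (ht : 0 ≤ t) : 0 ≤ expFun p t :=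
  mul_nonneg (Real.rpow_nonneg ht p) (Real.exp_pos _).le

theorem expFun_pos {t : ℝ} (ht : 0 < t) : 0 < expFun p t :=
  mul_pos (Real.rpow_pos_of_pos ht p) (Real.exp_pos _)

theorem expFun_one : expFun p 1 = 1 := by simp [expFun]

theorem expFun_zero (hp : 0 < p) : expFun p 0 = 0 := by
  rw [expFun, Real.zero_rpow (by linarith), zero_mul]

/-- The factor `exp ((s - 1) * t)` measures the failure of homogeneity; for `s < 1` it decreases in
`t`. All isometric information about the space comes from it. -/
theorem expFun_mul {s t : ℝ} (hs : 0 ≤ s) (ht : 0 ≤ t) :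
    expFun p (s * t) = s ^ p * Real.exp ((s - 1) * t) * expFun p t := by
  rw [expFun, expFun, Real.mul_rpow hs ht,
    show s * t - 1 = (s - 1) * t + (t - 1) by ring, Real.exp_add]
  ring

theorem expFun_lt (hp : 0 < p) {s t : ℝ} (hs : 0 ≤ s) (h : s < t) : expFun p s < expFun p t :=
  mul_lt_mul'' (Real.rpow_lt_rpow hs h (by linarith)) (Real.exp_lt_exp.2 (by linarith))
    (Real.rpow_nonneg hs p) (Real.exp_pos _).le

theorem expFun_le (hp : 0 < p) {s t : ℝ} (hs : 0 ≤ s) (h : s ≤ t) : expFun p s ≤ expFun p t :=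
  h.eq_or_lt.elim (fun h => h ▸ le_rfl) fun h => (expFun_lt hp hs h).le

theorem continuous_expFun (hp : 0 < p) : Continuous (expFun p) :=
  (Real.continuous_rpow_const (by linarith)).mul (by fun_prop)

theorem rpow_le_expFun {t : ℝ} (ht : 0 ≤ t) : t ^ p ≤ Real.exp 1 * expFun p t := by
  have h : Real.exp 1 * expFun p t = t ^ p * Real.exp t := by
    rw [expFun, mul_left_comm, ← Real.exp_add]
    ring_nf
  rw [h]
  exact le_mul_of_one_le_right (Real.rpow_nonneg ht p) (Real.one_le_exp ht)

theorem expFun_le_rpow {t B : ℝ} (ht : 0 ≤ t) (htB : t ≤ B) :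
    expFun p t ≤ Real.exp (B - 1) * t ^ p := by
  rw [expFun, mul_comm]
  gcongr

end expFun

section Modular

variable {p : ℝ} {x y : ℕ → ℝ}

theorem exists_bound_of_summable (hp : 3 < p) (h : Summable fun n => |x n| ^ p) :
    ∃ B, ∀ n, |x n| ≤ B := by
  refine ⟨1 + ∑' n, |x n| ^ p, fun n => ?_⟩
  have h1 : |x n| ^ p ≤ ∑' n, |x n| ^ p :=
    h.le_tsum n fun j _ => Real.rpow_nonneg (abs_nonneg _) p
  have h0 : 0 ≤ |x n| ^ p := Real.rpow_nonneg (abs_nonneg _) p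
  rcases le_total |x n| 1 with h2 | h2
  · linarith
  · have := Real.self_le_rpow_of_one_le h2 (by linarith : 1 ≤ p)
    linarith

theorem summable_expFun (hp : 3 < p) (h : Summable fun n => |x n| ^ p) :
    Summable fun n => expFun p |x n| := by
  obtain ⟨B, hB⟩ := exists_bound_of_summable hp h
  exact Summable.of_nonneg_of_le (fun n => expFun_nonneg (abs_nonneg _))
    (fun n => expFun_le_rpow (abs_nonneg _) (hB n)) (h.mul_left _)

theorem summable_rpow_of_expFun (h : Summable fun n => expFun p |x n|) :
    Summable fun n => |x n| ^ p :=
  Summable.of_nonneg_of_le (fun _ => Real.rpow_nonneg (abs_nonneg _) p)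
    (fun _ => rpow_le_expFun (abs_nonneg _)) (h.mul_left _)

theorem summable_rpow_smul (c : ℝ) (h : Summable fun n => |x n| ^ p) :
    Summable fun n => |(c • x) n| ^ p := by
  refine (h.mul_left (|c| ^ p)).congr fun n => ?_
  rw [Pi.smul_apply, smul_eq_mul, abs_mul, Real.mul_rpow (abs_nonneg _) (abs_nonneg _)]

theorem modular_nonneg : 0 ≤ modular p x := tsum_nonneg fun _ => expFun_nonneg (abs_nonneg _)

theorem expFun_le_modular (hp : 3 < p) (h : Summable fun n => |x n| ^ p) (n : ℕ) :
    expFun p |x n| ≤ modular p x :=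
  (summable_expFun hp h).le_tsum n fun _ _ => expFun_nonneg (abs_nonneg _)

theorem modular_smul_le (hp : 3 < p) (h : Summable fun n => |x n| ^ p) {r B : ℝ} (hr : 1 ≤ r)
    (hB : ∀ n, |x n| ≤ B) :
    modular p (r • x) ≤ r ^ p * Real.exp ((r - 1) * B) * modular p x := by
  rw [modular, modular, ← tsum_mul_left]
  refine Summable.tsum_le_tsum (fun n => ?_) (summable_expFun hp (summable_rpow_smul r h))
    ((summable_expFun hp h).mul_left _)
  have hr0 : 0 ≤ r := by linarith
  rw [Pi.smul_apply, smul_eq_mul, abs_mul, abs_of_nonneg hr0, expFun_mul hr0 (abs_nonneg _)]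
  have := expFun_nonneg (p := p) (abs_nonneg (x n))
  have : 0 ≤ r - 1 := by linarith
  gcongr
  exact hB n

/-- As `r - 1 ≤ 0`, the bound improves when `B` shrinks: vectors without large coordinates lose less
modular under contraction. -/
theorem le_modular_smul (hp : 3 < p) (h : Summable fun n => |x n| ^ p) {r B : ℝ} (hr : 0 ≤ r)
    (hr1 : r ≤ 1) (hB : ∀ n, |x n| ≤ B) :
    r ^ p * Real.exp ((r - 1) * B) * modular p x ≤ modular p (r • x) := by
  rw [modular, modular, ← tsum_mul_left]
  refine Summable.tsum_le_tsum (fun n => ?_) ((summable_expFun hp h).mul_left _)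
    (summable_expFun hp (summable_rpow_smul r h))
  rw [Pi.smul_apply, smul_eq_mul, abs_mul, abs_of_nonneg hr, expFun_mul hr (abs_nonneg _)]
  have h1 := expFun_nonneg (p := p) (abs_nonneg (x n))
  refine mul_le_mul_of_nonneg_right (mul_le_mul_of_nonneg_left (Real.exp_le_exp.2 ?_)
    (Real.rpow_nonneg hr p)) h1
  exact mul_le_mul_of_nonpos_left (hB n) (by linarith)

theorem modular_smul_le_smul (hp : 3 < p) (h : Summable fun n => |x n| ^ p) {r : ℝ} (hr : 0 ≤ r)
    (hr1 : r ≤ 1) : modular p (r • x) ≤ r ^ p * modular p x := by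
  rw [modular, modular, ← tsum_mul_left]
  refine Summable.tsum_le_tsum (fun n => ?_) (summable_expFun hp (summable_rpow_smul r h))
    ((summable_expFun hp h).mul_left _)
  rw [Pi.smul_apply, smul_eq_mul, abs_mul, abs_of_nonneg hr, expFun_mul hr (abs_nonneg _)]
  have h1 := expFun_nonneg (p := p) (abs_nonneg (x n))
  have h2 : Real.exp ((r - 1) * |x n|) ≤ 1 :=
    Real.exp_le_one_iff.2 (mul_nonpos_of_nonpos_of_nonneg (by linarith) (abs_nonneg _))
  have h3 := Real.rpow_nonneg hr p
  exact mul_le_mul_of_nonneg_right (mul_le_of_le_one_right h3 h2) h1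

theorem tendsto_scale (p B : ℝ) :
    Tendsto (fun r : ℝ => r ^ p * Real.exp ((r - 1) * B)) (𝓝[>] 1) (𝓝 1) := by
  have h : ContinuousAt (fun r : ℝ => r ^ p * Real.exp ((r - 1) * B)) 1 :=
    (Real.continuousAt_rpow_const 1 p (Or.inl one_ne_zero)).mul (by fun_prop)
  have h' := h.tendsto
  simp only [Real.one_rpow, sub_self, zero_mul, Real.exp_zero, mul_one] at h'
  exact h'.mono_left nhdsWithin_le_nhds

theorem mem_luxSet_iff (hp : 3 < p) {r : ℝ} (hr : 0 < r) (h : Summable fun n => |x n| ^ p) :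
    r ∈ (expOrlicz p hp).luxSet x ↔ modular p (r⁻¹ • x) ≤ 1 := by
  have e : ∀ n, (expOrlicz p hp) (|x n| / r) = expFun p |(r⁻¹ • x) n| := fun n => by
    rw [Pi.smul_apply, smul_eq_mul, abs_mul, abs_of_pos (inv_pos.2 hr), mul_comm, ← div_eq_mul_inv]
    rfl
  have hs := summable_expFun hp (summable_rpow_smul r⁻¹ h)
  simp only [OrliczFunction.luxSet, Set.mem_ofPred_eq, hr, true_and, e]
  rw [← ENNReal.ofReal_tsum_of_nonneg (fun n => expFun_nonneg (abs_nonneg _)) hs,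
    ENNReal.ofReal_le_one, modular]

theorem luxSet_nonempty_iff (hp : 3 < p) :
    ((expOrlicz p hp).luxSet x).Nonempty ↔ Summable fun n => |x n| ^ p := by
  constructor
  · rintro ⟨r, hr, h⟩
    have e : ∀ n, (expOrlicz p hp) (|x n| / r) = expFun p |(r⁻¹ • x) n| := fun n => by
      rw [Pi.smul_apply, smul_eq_mul, abs_mul, abs_of_pos (inv_pos.2 hr), mul_comm,
        ← div_eq_mul_inv]
      rfl
    simp only [e] at h
    have h1 := ENNReal.summable_toReal (h.trans_lt ENNReal.one_lt_top).ne
    have h2 : Summable fun n => expFun p |(r⁻¹ • x) n| :=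
      h1.congr fun n => ENNReal.toReal_ofReal (expFun_nonneg (abs_nonneg _))
    have h3 := summable_rpow_smul r (summable_rpow_of_expFun h2)
    rwa [smul_inv_smul₀ hr.ne'] at h3
  · intro h
    obtain ⟨B, hB⟩ := exists_bound_of_summable hp h
    set S := modular p x
    have hS : 0 ≤ S := modular_nonneg
    -- By convexity-type scaling, dividing by `S + 1 ≥ 1` brings the modular `S` down to at most `S
    -- / (S + 1)`.
    refine ⟨S + 1, (mem_luxSet_iff hp (by linarith) h).2 ?_⟩
    have h1 : (S + 1)⁻¹ ≤ 1 := inv_le_one_of_one_le₀ (by linarith)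
    have h0 : 0 ≤ (S + 1)⁻¹ := by positivity
    refine (modular_smul_le_smul hp h h0 h1).trans ?_
    have h2 : (S + 1)⁻¹ ^ p ≤ (S + 1)⁻¹ := by
      refine (Real.rpow_le_rpow_of_exponent_ge (by positivity) h1 (by linarith : 1 ≤ p)).trans ?_
      rw [Real.rpow_one]
    calc (S + 1)⁻¹ ^ p * S ≤ (S + 1)⁻¹ * (S + 1) := by gcongr; linarith
      _ = 1 := inv_mul_cancel₀ (by linarith)

end Modular

/-! ## The Orlicz sequence space of `t ^ p * e ^ (t - 1)` -/

/-- The Orlicz sequence space of the function `t ^ p * e ^ (t - 1)`. -/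
abbrev ExpSeq (p : ℝ) (hp : 3 < p) : Type := OrliczSeq (expOrlicz p hp)

namespace ExpSeq

variable {p : ℝ} {hp : 3 < p}

theorem summable (x : ExpSeq p hp) : Summable fun n => |x n| ^ p :=
  (luxSet_nonempty_iff hp).1 x.2

/-- The element of the sequence space given by a `p`-summable sequence. -/
def mk (hp : 3 < p) (x : ℕ → ℝ) (h : Summable fun n => |x n| ^ p) : ExpSeq p hp :=
  ⟨x, (luxSet_nonempty_iff hp).2 h⟩

theorem mk_apply (x : ℕ → ℝ) (h : Summable fun n => |x n| ^ p) (n : ℕ) : mk hp x h n = x n := rfl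

theorem ext {x y : ExpSeq p hp} (h : ∀ n, x n = y n) : x = y := Subtype.ext (funext h)

theorem add_apply (x y : ExpSeq p hp) (n : ℕ) : (x + y) n = x n + y n := rfl

theorem sub_apply (x y : ExpSeq p hp) (n : ℕ) : (x - y) n = x n - y n := rfl

theorem smul_apply (c : ℝ) (x : ExpSeq p hp) (n : ℕ) : (c • x) n = c * x n := rfl

theorem zero_apply (n : ℕ) : (0 : ExpSeq p hp) n = 0 := rfl

theorem coe_smul (c : ℝ) (x : ExpSeq p hp) : (c • x).1 = c • x.1 := rfl

/-- The coordinate functionals. -/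
def coord (p : ℝ) (hp : 3 < p) (n : ℕ) : ExpSeq p hp →ₗ[ℝ] ℝ where
  toFun x := x n
  map_add' _ _ := rfl
  map_smul' _ _ := rfl

theorem sum_apply {ι : Type*} (s : Finset ι) (f : ι → ExpSeq p hp) (n : ℕ) :
    (∑ i ∈ s, f i) n = ∑ i ∈ s, f i n := map_sum (coord p hp n) f s

/-- The infimum defining the norm is attained: the modular of `x` exceeds that of `r⁻¹ • x` by a
factor that tends to 1 as `r` decreases to 1. -/
theorem norm_le_one_iff {x : ExpSeq p hp} : ‖x‖ ≤ 1 ↔ modular p x ≤ 1 := by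
  constructor
  · intro h
    obtain ⟨B, hB⟩ := exists_bound_of_summable hp x.summable
    refine ge_of_tendsto (tendsto_scale p B) ?_
    filter_upwards [self_mem_nhdsWithin] with r (hr : 1 < r)
    have hr0 : 0 < r := by linarith
    have h1 := (mem_luxSet_iff hp hr0 x.summable).1
      ((expOrlicz p hp).mem_luxSet_of_lt x.2 (lt_of_le_of_lt h hr))
    have h2 := modular_smul_le hp (summable_rpow_smul r⁻¹ x.summable) hr.le (B := B) fun n => by
      rw [Pi.smul_apply, smul_eq_mul, abs_mul, abs_of_pos (inv_pos.2 hr0)]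
      exact (mul_le_of_le_one_left (abs_nonneg _) (inv_le_one_of_one_le₀ hr.le)).trans (hB n)
    rw [smul_inv_smul₀ hr0.ne'] at h2
    exact h2.trans (mul_le_of_le_one_right (by positivity) h1)
  · intro h
    refine (expOrlicz p hp).luxNorm_le ((mem_luxSet_iff hp one_pos x.summable).2 ?_)
    rwa [inv_one, one_smul]

/-- A modular below 1 leaves room to scale `x` up by some `r > 1` and stay in the unit ball. -/
theorem one_le_modular {x : ExpSeq p hp} (h : 1 ≤ ‖x‖) : 1 ≤ modular p x := by
  by_contra! hlt
  obtain ⟨B, hB⟩ := exists_bound_of_summable hp x.summable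
  have h1 := (tendsto_scale p B).mul_const (modular p x)
  rw [one_mul] at h1
  obtain ⟨r, hr1, hr⟩ := ((h1.eventually (gt_mem_nhds hlt)).and self_mem_nhdsWithin).exists
  have hr : 1 < r := hr
  have h2 := norm_le_one_iff (x := r • x).2
    ((modular_smul_le hp x.summable hr.le hB).trans hr1.le)
  rw [norm_smul, Real.norm_of_nonneg (by linarith)] at h2
  nlinarith

theorem modular_le_norm {x : ExpSeq p hp} (h : ‖x‖ ≤ 1) : modular p x ≤ ‖x‖ := by
  rcases (norm_nonneg x).eq_or_lt with h0 | h0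
  · rw [norm_eq_zero.1 h0.symm]
    change modular p 0 ≤ _
    simp [modular, expFun_zero (p := p) (by linarith)]
  · have h1 : ‖‖x‖⁻¹ • x‖ ≤ 1 := by
      rw [norm_smul, norm_inv, norm_norm, inv_mul_cancel₀ h0.ne']
    have h2 := modular_smul_le_smul hp (‖x‖⁻¹ • x).summable h0.le h
    rw [coe_smul, smul_inv_smul₀ h0.ne'] at h2
    refine h2.trans ?_
    have h3 := norm_le_one_iff.1 h1
    have h4 : ‖x‖ ^ p ≤ ‖x‖ := by
      refine (Real.rpow_le_rpow_of_exponent_ge h0 h (by linarith : 1 ≤ p)).trans ?_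
      rw [Real.rpow_one]
    exact (mul_le_of_le_one_right (by positivity) h3).trans h4

/-- After normalization a single term of the modular is at most `1 = M 1`, and `M` is strictly
increasing. -/
theorem abs_apply_le_norm (x : ExpSeq p hp) (n : ℕ) : |x n| ≤ ‖x‖ := by
  rcases (norm_nonneg x).eq_or_lt with h0 | h0
  · rw [norm_eq_zero.1 h0.symm, zero_apply, abs_zero, norm_zero]
  · have h1 : ‖‖x‖⁻¹ • x‖ ≤ 1 := by
      rw [norm_smul, norm_inv, norm_norm, inv_mul_cancel₀ h0.ne']
    have h2 := (expFun_le_modular hp (‖x‖⁻¹ • x).summable n).trans (norm_le_one_iff.1 h1)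
    have h3 : |(‖x‖⁻¹ • x) n| ≤ 1 := by
      by_contra! h
      have := expFun_lt (p := p) (by linarith) zero_le_one h
      rw [expFun_one] at this
      linarith
    rw [smul_apply, abs_mul, abs_inv, abs_norm] at h3
    rwa [inv_mul_le_iff₀ h0, mul_one] at h3

/-- For `r ^ p ≥ ∑ |x n| ^ p`, all coordinates of `r⁻¹ • x` are at most 1, and `M t ≤ t ^ p` on `[0,
1]`. -/
theorem norm_rpow_le (x : ExpSeq p hp) : ‖x‖ ^ p ≤ ∑' n, |x n| ^ p := by
  set S := ∑' n, |x n| ^ p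
  have hp0 : 0 < p := by linarith
  have hS : 0 ≤ S := tsum_nonneg fun n => Real.rpow_nonneg (abs_nonneg _) p
  have key : ∀ r, 0 < r → S ≤ r ^ p → ‖x‖ ≤ r := by
    intro r hr hSr
    have hle : ∀ n, |(r⁻¹ • x) n| ≤ 1 := fun n => by
      rw [smul_apply, abs_mul, abs_of_pos (inv_pos.2 hr), inv_mul_le_iff₀ hr, mul_one]
      refine (Real.rpow_le_rpow_iff (abs_nonneg _) hr.le hp0).1 (le_trans ?_ hSr)
      exact x.summable.le_tsum n fun _ _ => Real.rpow_nonneg (abs_nonneg _) p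
    have h1 : modular p (r⁻¹ • x).1 ≤ (r⁻¹) ^ p * S := by
      rw [← tsum_mul_left]
      refine Summable.tsum_le_tsum (fun n => ?_) (summable_expFun hp (r⁻¹ • x).summable)
        (x.summable.mul_left _)
      refine (expFun_le_rpow (abs_nonneg _) (hle n)).trans (le_of_eq ?_)
      rw [sub_self, Real.exp_zero, one_mul, smul_apply, abs_mul, abs_of_pos (inv_pos.2 hr),
        Real.mul_rpow (inv_pos.2 hr).le (abs_nonneg _)]
    have h2 : ‖r⁻¹ • x‖ ≤ 1 := by
      refine norm_le_one_iff.2 (h1.trans ?_)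
      rw [Real.inv_rpow hr.le, inv_mul_le_iff₀ (by positivity), mul_one]
      exact hSr
    rw [norm_smul, norm_inv, Real.norm_of_nonneg hr.le, inv_mul_le_iff₀ hr, mul_one] at h2
    exact h2
  refine le_of_forall_pos_le_add fun ε hε => ?_
  -- Adding `ε` keeps the radius positive even when `S = 0`.
  have h1 := key ((S + ε) ^ (p⁻¹)) (by positivity)
    (by rw [Real.rpow_inv_rpow (by positivity) hp0.ne']; linarith)
  have h2 := Real.rpow_le_rpow (norm_nonneg _) h1 hp0.le
  rwa [Real.rpow_inv_rpow (by positivity) hp0.ne'] at h2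

theorem tsum_rpow_le (x : ExpSeq p hp) : ∑' n, |x n| ^ p ≤ Real.exp 1 * ‖x‖ ^ p := by
  rcases (norm_nonneg x).eq_or_lt with h0 | h0
  · rw [norm_eq_zero.1 h0.symm]
    simp [zero_apply, Real.zero_rpow (by linarith : p ≠ 0)]
  · have h1 : ‖‖x‖⁻¹ • x‖ ≤ 1 := by
      rw [norm_smul, norm_inv, norm_norm, inv_mul_cancel₀ h0.ne']
    have h2 := norm_le_one_iff.1 h1
    set y := ‖x‖⁻¹ • x with hy
    have hxy : x = ‖x‖ • y := by rw [hy, smul_inv_smul₀ h0.ne']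
    have h3 : ∑' n, |y n| ^ p ≤ Real.exp 1 * modular p y := by
      rw [modular, ← tsum_mul_left]
      exact Summable.tsum_le_tsum (fun n => rpow_le_expFun (abs_nonneg _)) y.summable
        ((summable_expFun hp y.summable).mul_left _)
    have h4 : ∑' n, |x n| ^ p = ‖x‖ ^ p * ∑' n, |y n| ^ p := by
      rw [← tsum_mul_left]
      refine tsum_congr fun n => ?_
      conv_lhs => rw [hxy]
      rw [smul_apply, abs_mul, abs_norm, Real.mul_rpow h0.le (abs_nonneg _)]
    rw [h4, mul_comm]
    have h5 : ∑' n, |y n| ^ p ≤ Real.exp 1 :=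
      h3.trans (mul_le_of_le_one_right (Real.exp_pos _).le h2)
    gcongr

/-! ### Identification with `ℓ_p`; completeness and separability -/

theorem fact_one_le (hp : 3 < p) : Fact (1 ≤ ENNReal.ofReal p) :=
  ⟨ENNReal.one_le_ofReal.2 (by linarith)⟩

theorem toReal_exponent (hp : 3 < p) : (ENNReal.ofReal p).toReal = p :=
  ENNReal.toReal_ofReal (by linarith)

/-- The identification with `ℓ_p` as a vector space. -/
def lpLinearEquiv (p : ℝ) (hp : 3 < p) :
    ExpSeq p hp ≃ₗ[ℝ] lp (fun _ : ℕ => ℝ) (ENNReal.ofReal p) where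
  toFun x := ⟨x.1, memℓp_gen (by
    simpa only [toReal_exponent hp, Real.norm_eq_abs] using x.summable)⟩
  invFun y := mk hp y.1 (by
    have h := (lp.memℓp y).summable (by rw [toReal_exponent hp]; linarith)
    simpa only [toReal_exponent hp, Real.norm_eq_abs] using h)
  map_add' _ _ := rfl
  map_smul' _ _ := rfl
  left_inv _ := rfl
  right_inv _ := rfl

theorem lpLinearEquiv_apply (x : ExpSeq p hp) (n : ℕ) : lpLinearEquiv p hp x n = x n := rfl

theorem norm_lpLinearEquiv_rpow (x : ExpSeq p hp) :
    ‖lpLinearEquiv p hp x‖ ^ p = ∑' n, |x n| ^ p := by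
  have := lp.norm_rpow_eq_tsum (by rw [toReal_exponent hp]; linarith) (lpLinearEquiv p hp x)
  simpa only [toReal_exponent hp, Real.norm_eq_abs, lpLinearEquiv_apply] using this

/-- The identification with `ℓ_p` up to an equivalent norm. -/
noncomputable def lpEquiv (p : ℝ) (hp : 3 < p) :
    haveI := fact_one_le hp
    ExpSeq p hp ≃L[ℝ] lp (fun _ : ℕ => ℝ) (ENNReal.ofReal p) :=
  haveI := fact_one_le hp
  (lpLinearEquiv p hp).toContinuousLinearEquivOfBounds (Real.exp 1 ^ p⁻¹) 1
    (fun x => by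
      have hp0 : 0 < p := by linarith
      refine (Real.rpow_le_rpow_iff (norm_nonneg _) (by positivity) hp0).1 ?_
      rw [norm_lpLinearEquiv_rpow, Real.mul_rpow (by positivity) (norm_nonneg _),
        Real.rpow_inv_rpow (Real.exp_pos _).le hp0.ne']
      exact tsum_rpow_le x)
    (fun y => by
      have hp0 : 0 < p := by linarith
      obtain ⟨x, rfl⟩ := (lpLinearEquiv p hp).surjective y
      rw [one_mul, LinearEquiv.symm_apply_apply]
      refine (Real.rpow_le_rpow_iff (norm_nonneg _) (norm_nonneg _) hp0).1 ?_
      rw [norm_lpLinearEquiv_rpow]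
      exact norm_rpow_le x)

theorem lpEquiv_apply (x : ExpSeq p hp) (n : ℕ) : lpEquiv p hp x n = x n := rfl

theorem completeSpace : CompleteSpace (ExpSeq p hp) := by
  have := fact_one_le hp
  exact (completeSpace_congr (e := (lpEquiv p hp).toEquiv) (lpEquiv p hp).isUniformEmbedding).2
    inferInstance

variable (hp) in
/-- The unit vectors. -/
def unit (n : ℕ) : ExpSeq p hp :=
  mk hp (Pi.single n 1) (summable_of_ne_finset_zero (s := {n}) fun m hm => by
    rw [Pi.single_eq_of_ne (by simpa using hm), abs_zero, Real.zero_rpow (by linarith)])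

theorem unit_apply (n m : ℕ) : unit hp n m = if m = n then 1 else 0 := by
  rw [unit, mk_apply, Pi.single_apply]

theorem hasSum_unit (x : ExpSeq p hp) : HasSum (fun n => x n • unit hp n) x := by
  have := fact_one_le hp
  have h := lp.hasSum_single (p := ENNReal.ofReal p) ENNReal.ofReal_ne_top (lpEquiv p hp x)
  refine (lpEquiv p hp).hasSum'.1 (h.congr_fun fun n => ?_)
  refine lp.ext (funext fun m => ?_)
  rw [lp.single_apply, lpEquiv_apply, lpEquiv_apply, smul_apply, unit_apply, Pi.single_apply]
  split_ifs with h
  · simp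
  · simp

theorem separableSpace : TopologicalSpace.SeparableSpace (ExpSeq p hp) := by
  refine TopologicalSpace.isSeparable_univ_iff.1 ?_
  have h := ((Set.countable_range (unit hp)).isSeparable.span (R := ℝ)).closure
  refine h.mono fun x _ => ?_
  refine mem_closure_of_tendsto (hasSum_unit x).tendsto_sum_nat (Eventually.of_forall fun n => ?_)
  exact Submodule.sum_mem _ fun i _ => Submodule.smul_mem _ _ (Submodule.subset_span ⟨i, rfl⟩)

theorem modular_unit (n : ℕ) : modular p (unit hp n) = 1 := by
  rw [modular, tsum_eq_single n]
  · simp [unit_apply, expFun_one]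
  · intro m hm
    simp [unit_apply, hm, expFun_zero (p := p) (by linarith)]

theorem norm_eq_one {x : ExpSeq p hp} (h : modular p x = 1) : ‖x‖ = 1 :=
  le_antisymm (norm_le_one_iff.2 h.le) (by
    by_contra! hlt
    have := modular_le_norm hlt.le
    linarith)

theorem norm_unit (n : ℕ) : ‖unit hp n‖ = 1 := norm_eq_one (modular_unit n)

/-! ### Isometries from signed permutations -/

variable (hp) in
/-- Permuting the coordinates and changing signs. -/
noncomputable def signedPermFun (σ : Equiv.Perm ℕ) (c : ℕ → ℤˣ) (x : ExpSeq p hp) : ExpSeq p hp :=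
  mk hp (fun n => ((c n : ℤ) : ℝ) * x (σ n)) (by
    have h : ∀ n, |((c n : ℤ) : ℝ) * x (σ n)| = |x (σ n)| := fun n => by
      rcases Int.units_eq_one_or (c n) with h | h <;> simp [h]
    simp only [h]
    exact (Equiv.summable_iff σ).2 x.summable)

theorem signedPermFun_apply (σ : Equiv.Perm ℕ) (c : ℕ → ℤˣ) (x : ExpSeq p hp) (n : ℕ) :
    signedPermFun hp σ c x n = ((c n : ℤ) : ℝ) * x (σ n) := rfl

theorem luxSet_signedPermFun (σ : Equiv.Perm ℕ) (c : ℕ → ℤˣ) (x : ExpSeq p hp) :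
    (expOrlicz p hp).luxSet (signedPermFun hp σ c x) = (expOrlicz p hp).luxSet x := by
  ext r
  have h : ∀ n, |signedPermFun hp σ c x n| = |x (σ n)| := fun n => by
    rw [signedPermFun_apply]
    rcases Int.units_eq_one_or (c n) with h | h <;> simp [h]
  simp only [OrliczFunction.luxSet, Set.mem_ofPred_eq, h]
  rw [Equiv.tsum_eq σ fun n => ENNReal.ofReal ((expOrlicz p hp) (|x n| / r))]

variable (hp) in
/-- The isometry given by a permutation of the coordinates and a choice of signs. -/
noncomputable def signedPerm (σ : Equiv.Perm ℕ) (c : ℕ → ℤˣ) : ExpSeq p hp ≃ₗᵢ[ℝ] ExpSeq p hp where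
  toFun := signedPermFun hp σ c
  invFun := signedPermFun hp σ.symm fun n => c (σ.symm n)
  map_add' _ _ := ext fun n => mul_add _ _ _
  map_smul' _ _ := ext fun n => mul_left_comm _ _ _
  left_inv x := ext fun n => by
    simp only [signedPermFun_apply, Equiv.apply_symm_apply]
    rcases Int.units_eq_one_or (c (σ.symm n)) with h | h <;> simp [h]
  right_inv x := ext fun n => by
    simp only [signedPermFun_apply, Equiv.symm_apply_apply]
    rcases Int.units_eq_one_or (c n) with h | h <;> simp [h]
  norm_map' x := by
    change (expOrlicz p hp).luxNorm (signedPermFun hp σ c x) = (expOrlicz p hp).luxNorm x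
    rw [OrliczFunction.luxNorm, luxSet_signedPermFun]
    rfl

theorem signedPerm_unit (σ : Equiv.Perm ℕ) (c : ℕ → ℤˣ) (n : ℕ) :
    signedPerm hp σ c (unit hp (σ n)) = ((c n : ℤ) : ℝ) • unit hp n := by
  refine ext fun m => ?_
  change ((c m : ℤ) : ℝ) * unit hp (σ n) (σ m) = _
  rw [smul_apply, unit_apply, unit_apply]
  by_cases h : m = n
  · rw [h]
    simp
  · simp [h]

end ExpSeq

/-! ### Parallelogram and Clarkson inequalities -/

section expFun

variable {p : ℝ}

/-- The square obeys the parallelogram identity exactly, and the remaining factor is still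
increasing and convex because `p - 2 ≥ 1`. -/
theorem expFun_eq_sq_mul (hp : 3 < p) {t : ℝ} (ht : 0 ≤ t) :
    expFun p t = t ^ 2 * expFun (p - 2) t := by
  rw [expFun, expFun, ← mul_assoc, ← Real.rpow_natCast, ← Real.rpow_add' ht]
  · norm_num
  · norm_num
    linarith

theorem convexOn_expFun (hp : 1 ≤ p) : ConvexOn ℝ (Set.Ici 0) (expFun p) := by
  have hexp : ConvexOn ℝ (Set.Ici 0) (fun t : ℝ => Real.exp (t - 1)) := by
    refine ((convexOn_exp.subset (Set.subset_univ _) (convex_Ici 0)).smul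
      (Real.exp_pos (-1)).le).congr fun t _ => ?_
    change Real.exp (-1) * Real.exp t = _
    rw [← Real.exp_add]
    ring_nf
  refine ConvexOn.mul (convexOn_rpow hp) hexp (fun t ht => Real.rpow_nonneg ht p)
    (fun t _ => (Real.exp_pos _).le) (MonotoneOn.monovaryOn ?_ ?_)
  · exact fun s hs t _ hst => Real.rpow_le_rpow hs hst (by linarith)
  · exact fun s _ t _ hst => Real.exp_le_exp.2 (by linarith)

theorem two_mul_expFun_abs_le (hp : 1 ≤ p) (u v : ℝ) :
    2 * expFun p |u| ≤ expFun p |u + v| + expFun p |u - v| := by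
  have h := (convexOn_expFun hp).2 (Set.mem_Ici.2 (abs_nonneg (u + v)))
    (Set.mem_Ici.2 (abs_nonneg (u - v))) (by norm_num : (0 : ℝ) ≤ 1 / 2)
    (by norm_num : (0 : ℝ) ≤ 1 / 2) (by norm_num)
  simp only [smul_eq_mul] at h
  have h1 : |u| ≤ 1 / 2 * |u + v| + 1 / 2 * |u - v| := by
    have := abs_add_le (u + v) (u - v)
    rw [show u + v + (u - v) = 2 * u by ring, abs_mul, abs_two] at this
    linarith
  have h2 := expFun_le (p := p) (by linarith) (abs_nonneg u) h1
  linarith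

/-- A quantitative parallelogram inequality. -/
theorem parallelogram_expFun (hp : 3 < p) (u v : ℝ) :
    2 * (u ^ 2 + v ^ 2) * expFun (p - 2) |u| ≤ expFun p |u + v| + expFun p |u - v| := by
  rw [expFun_eq_sq_mul hp (abs_nonneg (u + v)), expFun_eq_sq_mul hp (abs_nonneg (u - v)),
    sq_abs, sq_abs]
  -- With `A`, `B` the values of `expFun (p - 2)` at `|u + v|`, `|u - v|`, the right side is `(u ^ 2
  -- + v ^ 2) * (A + B) + 2 * u * v * (A - B)`. Convexity handles the first term; in the second, `u
  -- * v` and `A - B` have the same sign.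
  have h1 := two_mul_expFun_abs_le (p := p - 2) (by linarith) u v
  have h2 : 0 ≤ u * v * (expFun (p - 2) |u + v| - expFun (p - 2) |u - v|) := by
    rcases le_total 0 (u * v) with h | h
    · refine mul_nonneg h (sub_nonneg.2 (expFun_le (p := p - 2) (by linarith) (abs_nonneg _) ?_))
      exact sq_le_sq.1 (by nlinarith)
    · refine mul_nonneg_of_nonpos_of_nonpos h
        (sub_nonpos.2 (expFun_le (p := p - 2) (by linarith) (abs_nonneg _) ?_))
      exact sq_le_sq.1 (by nlinarith)
  nlinarith [mul_le_mul_of_nonneg_left h1 (by positivity : 0 ≤ u ^ 2 + v ^ 2)]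

/-- By symmetry `|v| ≤ |u|`; then monotonicity replaces `expFun (p - 2) |u|` by its value at `|v|`
in the `v ^ 2` term of the parallelogram inequality. -/
theorem clarkson_expFun (hp : 3 < p) (u v : ℝ) :
    2 * (expFun p |u| + expFun p |v|) ≤ expFun p |u + v| + expFun p |u - v| := by
  have key : ∀ u v : ℝ, |v| ≤ |u| →
      2 * (expFun p |u| + expFun p |v|) ≤ expFun p |u + v| + expFun p |u - v| := by
    intro u v h
    refine le_trans (le_of_sub_nonneg ?_) (parallelogram_expFun hp u v)
    rw [expFun_eq_sq_mul hp (abs_nonneg u), expFun_eq_sq_mul hp (abs_nonneg v), sq_abs, sq_abs]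
    have h1 := expFun_le (p := p - 2) (by linarith) (abs_nonneg v) h
    nlinarith [mul_le_mul_of_nonneg_left h1 (sq_nonneg v)]
  rcases le_total |v| |u| with h | h
  · exact key u v h
  · have := key v u h
    rwa [add_comm v u, abs_sub_comm v u, add_comm (expFun p |v|)] at this

end expFun

/-! ### Rigidity of the unit vectors -/

namespace ExpSeq

variable {p : ℝ} {hp : 3 < p}

theorem clarkson (f g : ExpSeq p hp) :
    2 * (modular p f + modular p g) ≤ modular p (f + g).1 + modular p (f - g).1 := by
  have hf := summable_expFun hp f.summable
  have hg := summable_expFun hp g.summable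
  have h1 := summable_expFun hp (f + g).summable
  have h2 := summable_expFun hp (f - g).summable
  rw [modular, modular, modular, modular, ← hf.tsum_add hg, ← h1.tsum_add h2, ← tsum_mul_left]
  exact Summable.tsum_le_tsum (fun n => clarkson_expFun hp _ _) ((hf.add hg).mul_left 2)
    (h1.add h2)

theorem modular_add_of_disjoint {f g : ExpSeq p hp} (h : ∀ n, f n = 0 ∨ g n = 0) :
    modular p (f + g).1 = modular p f + modular p g := by
  rw [modular, modular, modular,
    ← (summable_expFun hp f.summable).tsum_add (summable_expFun hp g.summable)]
  refine tsum_congr fun n => ?_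
  rw [add_apply]
  rcases h n with h | h <;> simp [h, expFun_zero (by linarith : 0 < p)]

theorem sum_unit_apply (s : Finset ℕ) (c : ℕ → ℝ) (n : ℕ) :
    (∑ i ∈ s, c i • unit hp i) n = if n ∈ s then c n else 0 := by
  simp [sum_apply, smul_apply, unit_apply]

theorem modular_sum_unit (s : Finset ℕ) (c : ℕ → ℝ) :
    modular p (∑ i ∈ s, c i • unit hp i).1 = ∑ i ∈ s, expFun p |c i| := by
  rw [modular, tsum_eq_sum (s := s)]
  · exact Finset.sum_congr rfl fun i hi => by rw [sum_unit_apply, if_pos hi]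
  · intro n hn
    rw [sum_unit_apply, if_neg hn, abs_zero, expFun_zero (p := p) (by linarith)]

theorem exists_expFun_eq (hp : 3 < p) {s b : ℝ} (hs : 0 < s) (hb : 0 < b) (hsb : s ≤ expFun p b) :
    ∃ a, 0 < a ∧ a ≤ b ∧ expFun p a = s := by
  obtain ⟨a, ha, hs'⟩ := intermediate_value_Icc hb.le
    (continuous_expFun (by linarith : 0 < p)).continuousOn
    ⟨(expFun_zero (p := p) (by linarith)).le.trans hs.le, hsb⟩
  refine ⟨a, ha.1.lt_of_ne ?_, ha.2, hs'⟩
  rintro rfl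
  rw [expFun_zero (p := p) (by linarith)] at hs'
  exact hs.ne hs'

theorem norm_unit_add_unit {a : ℝ} (ha : 0 < a) (ha' : expFun p a = 1 / 2) {i j : ℕ} (hij : i ≠ j)
    (s : ℤˣ) : ‖unit hp i + ((s : ℤ) : ℝ) • unit hp j‖ = a⁻¹ := by
  have h : modular p (a • (unit hp i + ((s : ℤ) : ℝ) • unit hp j)).1 = 1 := by
    have e : a • (unit hp i + ((s : ℤ) : ℝ) • unit hp j) =
        ∑ k ∈ {i, j}, (if k = i then a else a * s) • unit hp k := by
      rw [Finset.sum_pair hij, if_pos rfl, if_neg hij.symm, smul_add, smul_smul]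
    rw [e, modular_sum_unit, Finset.sum_pair hij, if_pos rfl, if_neg hij.symm]
    rcases Int.units_eq_one_or s with rfl | rfl <;> simp [abs_of_pos ha, ha'] <;> norm_num
  have h' := norm_eq_one h
  rw [norm_smul, Real.norm_of_nonneg ha.le] at h'
  exact eq_inv_of_mul_eq_one_right h'

/-- If `f`, `g` almost span the plane of two unit vectors, then `f` has a coordinate of modulus
close to one. -/
theorem exists_large_coord {a m q : ℝ} (ha : 0 < a) (ha1 : a < 1) (hq : 1 ≤ q)
    (h : 1 < (a / q ^ 2) ^ p *
      (Real.exp ((a / q ^ 2 - 1) * m) + Real.exp ((a / q ^ 2 - 1) * q ^ 2)))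
    {f g : ExpSeq p hp} (hf : 1 ≤ q * ‖f‖) (hg : 1 ≤ q * ‖g‖) (hg' : ‖g‖ ≤ q)
    (hadd : ‖f + g‖ ≤ q * a⁻¹) (hsub : ‖f - g‖ ≤ q * a⁻¹) : ∃ n, m < q * |f n| := by
  by_contra! hm
  have hq0 : 0 < q := by linarith
  -- This scale puts `b • q • (f ± g)` into the unit ball, while `q • f` and `q • g` have norm at
  -- least 1.
  set b := a / q ^ 2 with hb
  have hb0 : 0 ≤ b := by positivity
  have hb1 : b ≤ 1 := (div_le_one (by positivity)).2 (by nlinarith)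
  have hF : 1 ≤ modular p (q • f).1 := one_le_modular (by
    rwa [norm_smul, Real.norm_of_nonneg hq0.le])
  have hG : 1 ≤ modular p (q • g).1 := one_le_modular (by
    rwa [norm_smul, Real.norm_of_nonneg hq0.le])
  -- The negated conclusion supplies the sup bound `m` for `q • f`; for `q • g` only `q ^ 2` is
  -- available. By Clarkson the two lower bounds sum to at most 1, against `h`.
  have h1 := le_modular_smul hp (q • f).summable hb0 hb1 (B := m) fun n => by
    rw [smul_apply, abs_mul, abs_of_pos hq0]
    exact hm n
  have h2 := le_modular_smul hp (q • g).summable hb0 hb1 (B := q ^ 2) fun n => by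
    rw [smul_apply, abs_mul, abs_of_pos hq0, sq]
    exact mul_le_mul_of_nonneg_left ((abs_apply_le_norm g n).trans hg') hq0.le
  have h3 := clarkson (b • q • f) (b • q • g)
  have key : ∀ x : ExpSeq p hp, ‖x‖ ≤ q * a⁻¹ → modular p (b • q • x).1 ≤ 1 := fun x hx => by
    refine norm_le_one_iff.1 ?_
    rw [smul_smul, norm_smul, Real.norm_of_nonneg (by positivity), hb]
    calc a / q ^ 2 * q * ‖x‖ ≤ a / q ^ 2 * q * (q * a⁻¹) := by gcongr
      _ = 1 := by field_simp
  have h4 := key _ hadd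
  have h5 := key _ hsub
  rw [smul_add, smul_add] at h4
  rw [smul_sub, smul_sub] at h5
  rw [coe_smul b, coe_smul b] at h3
  have hc : 0 ≤ b ^ p := Real.rpow_nonneg hb0 p
  have h6 : b ^ p * Real.exp ((b - 1) * m) ≤ modular p (b • (q • f).1) :=
    (le_mul_of_one_le_right (by positivity) hF).trans h1
  have h7 : b ^ p * Real.exp ((b - 1) * q ^ 2) ≤ modular p (b • (q • g).1) :=
    (le_mul_of_one_le_right (by positivity) hG).trans h2
  linarith

/-- The vector `m • f` has modular at most 1, and its `n`-th coordinate already uses up `M (m ^ 3)`,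
so little is left for the others. At `n`, `|f n|` lies in `[m ^ 2, m⁻¹]`; the first two terms cover
the cases below and above 1. The whole bound tends to 0 as `m → 1`. -/
theorem norm_sub_unit_rpow_le {m : ℝ} (hm : 0 < m) (hm1 : m ≤ 1) {f : ExpSeq p hp}
    (hf : m * ‖f‖ ≤ 1) {n : ℕ} (hn : m ^ 2 ≤ |f n|) :
    ∃ s : ℤˣ, ‖f - ((s : ℤ) : ℝ) • unit hp n‖ ^ p ≤
      (1 - m ^ 2) ^ p + (m⁻¹ - 1) ^ p + m⁻¹ ^ p * (Real.exp 1 * (1 - expFun p (m ^ 3))) := by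
  obtain ⟨s, hs⟩ : ∃ s : ℤˣ, |f n - ((s : ℤ) : ℝ)| = |(|f n| - 1)| := by
    rcases le_total 0 (f n) with h | h
    · exact ⟨1, by rw [abs_of_nonneg h]; simp⟩
    · refine ⟨-1, ?_⟩
      rw [abs_of_nonpos h, ← abs_neg]
      congr 1
      push_cast [Units.val_neg, Units.val_one]
      ring
  refine ⟨s, (norm_rpow_le _).trans ?_⟩
  set y := f - ((s : ℤ) : ℝ) • unit hp n with hy
  have hyn : y n = f n - ((s : ℤ) : ℝ) := by
    rw [hy, sub_apply, smul_apply, unit_apply, if_pos rfl, mul_one]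
  have hyk : ∀ k, k ≠ n → y k = f k := fun k hk => by
    rw [hy, sub_apply, smul_apply, unit_apply, if_neg hk, mul_zero, sub_zero]
  have hfn : |f n| ≤ m⁻¹ := by
    refine (abs_apply_le_norm f n).trans ?_
    rwa [← one_div, le_div_iff₀ hm, mul_comm]
  rw [y.summable.tsum_eq_add_tsum_ite n, hyn, hs]
  have hm1' : 1 ≤ m⁻¹ := (one_le_inv₀ hm).2 hm1
  have hp0 : 0 < p := by linarith
  have hm2 : m ^ 2 ≤ 1 := pow_le_one₀ hm.le hm1
  refine add_le_add ?_ ?_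
  · have n1 : 0 ≤ (1 - m ^ 2) ^ p := Real.rpow_nonneg (by linarith) p
    have n2 : 0 ≤ (m⁻¹ - 1) ^ p := Real.rpow_nonneg (by linarith) p
    rcases le_total 0 (|f n| - 1) with h | h
    · rw [abs_of_nonneg h]
      have := Real.rpow_le_rpow h (by linarith : |f n| - 1 ≤ m⁻¹ - 1) hp0.le
      linarith
    · rw [abs_of_nonpos h]
      have := Real.rpow_le_rpow (by linarith : 0 ≤ -(|f n| - 1))
        (by linarith : -(|f n| - 1) ≤ 1 - m ^ 2) hp0.le
      linarith
  · have hmod : modular p (m • f).1 ≤ 1 :=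
      norm_le_one_iff.1 (by rwa [norm_smul, Real.norm_of_nonneg hm.le])
    have hsum := summable_expFun hp (m • f).summable
    rw [modular, hsum.tsum_eq_add_tsum_ite n] at hmod
    have h3 : expFun p (m ^ 3) ≤ expFun p |(m • f) n| := by
      refine expFun_le hp0 (by positivity) ?_
      rw [smul_apply, abs_mul, abs_of_pos hm]
      nlinarith
    have hs1 : Summable fun k => if k = n then 0 else expFun p |(m • f) k| :=
      Summable.of_nonneg_of_le (fun k => by
        split_ifs
        exacts [le_rfl, expFun_nonneg (abs_nonneg _)]) (fun k => by
        split_ifs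
        exacts [expFun_nonneg (abs_nonneg _), le_rfl]) hsum
    have hs2 : Summable fun k => if k = n then 0 else |y k| ^ p :=
      Summable.of_nonneg_of_le (fun k => by
        split_ifs
        exacts [le_rfl, Real.rpow_nonneg (abs_nonneg _) p]) (fun k => by
        split_ifs
        exacts [Real.rpow_nonneg (abs_nonneg _) p, le_rfl]) y.summable
    have h4 : ∑' k, (if k = n then 0 else |y k| ^ p) ≤
        m⁻¹ ^ p * (Real.exp 1 * ∑' k, if k = n then 0 else expFun p |(m • f) k|) := by
      rw [← tsum_mul_left, ← tsum_mul_left]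
      refine Summable.tsum_le_tsum (fun k => ?_) hs2 ((hs1.mul_left _).mul_left _)
      split_ifs with hk
      · simp
      · have e : |y k| = m⁻¹ * |(m • f) k| := by
          rw [hyk k hk, smul_apply, abs_mul, abs_of_pos hm, inv_mul_cancel_left₀ hm.ne']
        rw [e, Real.mul_rpow (by positivity) (abs_nonneg _)]
        exact mul_le_mul_of_nonneg_left (rpow_le_expFun (abs_nonneg _)) (by positivity)
    refine h4.trans ?_
    gcongr
    linarith

variable (hp) in
/-- Two vectors that almost behave like two unit vectors are close to signed unit vectors. -/
theorem exists_near_unit {η : ℝ} (hη : 0 < η) : ∃ δ : ℝ, 0 < δ ∧ δ ≤ 1 ∧ ∀ f g : ExpSeq p hp,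
    ‖f‖ ≤ 1 + δ → 1 ≤ (1 + δ) * ‖f‖ → ‖g‖ ≤ 1 + δ → 1 ≤ (1 + δ) * ‖g‖ →
    ‖f + g‖ ≤ (1 + δ) * ‖unit hp 0 + unit hp 1‖ → ‖f - g‖ ≤ (1 + δ) * ‖unit hp 0 + unit hp 1‖ →
    ∃ (n : ℕ) (s : ℤˣ), ‖f - ((s : ℤ) : ℝ) • unit hp n‖ ≤ η := by
  have hp0 : 0 < p := by linarith
  obtain ⟨a, ha, ha1, hM⟩ := exists_expFun_eq hp (s := 1 / 2) (b := 1) (by norm_num) one_pos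
    (by rw [expFun_one]; norm_num)
  have ha1 : a < 1 := ha1.lt_of_ne (by
    rintro rfl
    rw [expFun_one] at hM
    norm_num at hM)
  have hR : ‖unit hp 0 + unit hp 1‖ = a⁻¹ := by
    simpa using norm_unit_add_unit (hp := hp) ha hM zero_ne_one 1
  obtain ⟨m, hm0, hm1, hm⟩ : ∃ m : ℝ, 0 < m ∧ m < 1 ∧ (1 - m ^ 2) ^ p + (m⁻¹ - 1) ^ p +
      m⁻¹ ^ p * (Real.exp 1 * (1 - expFun p (m ^ 3))) < η ^ p := by
    have hc : ContinuousAt (fun m : ℝ => (1 - m ^ 2) ^ p + (m⁻¹ - 1) ^ p +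
        m⁻¹ ^ p * (Real.exp 1 * (1 - expFun p (m ^ 3)))) 1 := by
      have h1 : ContinuousAt (fun m : ℝ => m⁻¹) 1 := continuousAt_inv₀ one_ne_zero
      have h2 : ContinuousAt (fun m : ℝ => expFun p (m ^ 3)) 1 :=
        ((continuous_expFun hp0).comp (continuous_pow 3)).continuousAt
      refine ((ContinuousAt.rpow_const (by fun_prop) (Or.inr hp0.le)).add
        ((h1.sub continuousAt_const).rpow_const (Or.inr hp0.le))).add
        ((h1.rpow_const (Or.inr hp0.le)).mul (continuousAt_const.mul (continuousAt_const.sub h2)))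
    have h := hc.tendsto
    simp only [one_pow, sub_self, inv_one, Real.zero_rpow hp0.ne', expFun_one, mul_zero,
      add_zero] at h
    have h' := (h.mono_left (nhdsWithin_le_nhds (s := Set.Iio 1))).eventually
      (gt_mem_nhds (Real.rpow_pos_of_pos hη p))
    obtain ⟨m, h1, h2⟩ := (h'.and (Ioo_mem_nhdsLT zero_lt_one)).exists
    exact ⟨m, h2.1, h2.2, h1⟩
  -- At `δ = 0` the last inequality reads `1 < a ^ p * (exp ((a - 1) * m) + exp (a - 1))`. It is
  -- strict because `m < 1` and `2 * M a = 1`, hence survives for small `δ`.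
  obtain ⟨δ, hδ0, hδ1, hδm, hδ⟩ : ∃ δ : ℝ, 0 < δ ∧ δ ≤ 1 ∧ m * (1 + δ) ≤ 1 ∧
      1 < (a / (1 + δ) ^ 2) ^ p * (Real.exp ((a / (1 + δ) ^ 2 - 1) * m) +
        Real.exp ((a / (1 + δ) ^ 2 - 1) * (1 + δ) ^ 2)) := by
    have hd : ContinuousAt (fun δ : ℝ => a / (1 + δ) ^ 2) 0 :=
      ContinuousAt.div (by fun_prop) (by fun_prop) (by norm_num)
    have hc : ContinuousAt (fun δ : ℝ => (a / (1 + δ) ^ 2) ^ p *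
        (Real.exp ((a / (1 + δ) ^ 2 - 1) * m) +
        Real.exp ((a / (1 + δ) ^ 2 - 1) * (1 + δ) ^ 2))) 0 :=
      (hd.rpow_const (Or.inr hp0.le)).mul
        ((((hd.sub continuousAt_const).mul continuousAt_const).rexp).add
        (((hd.sub continuousAt_const).mul (by fun_prop)).rexp))
    have h := hc.tendsto
    simp only [add_zero, one_pow, div_one, mul_one] at h
    have hlt : 1 < a ^ p * (Real.exp ((a - 1) * m) + Real.exp (a - 1)) := by
      have h1 : Real.exp (a - 1) < Real.exp ((a - 1) * m) := Real.exp_lt_exp.2 (by nlinarith)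
      have h2 : 0 < a ^ p := Real.rpow_pos_of_pos ha p
      rw [expFun] at hM
      nlinarith
    have h1 := (h.mono_left (nhdsWithin_le_nhds (s := Set.Ioi 0))).eventually
      (lt_mem_nhds hlt)
    have h2 : ∀ᶠ δ : ℝ in 𝓝[>] 0, m * (1 + δ) < 1 := by
      have : ContinuousAt (fun δ : ℝ => m * (1 + δ)) 0 := by fun_prop
      refine (this.tendsto.mono_left nhdsWithin_le_nhds).eventually (gt_mem_nhds ?_)
      simpa using hm1
    obtain ⟨δ, ⟨h3, h4⟩, h5⟩ := ((h1.and h2).and (Ioo_mem_nhdsGT zero_lt_one)).exists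
    exact ⟨δ, h5.1, h5.2.le, h4.le, h3⟩
  refine ⟨δ, hδ0, hδ1, fun f g hf hf' hg hg' hadd hsub => ?_⟩
  rw [hR] at hadd hsub
  obtain ⟨n, hn⟩ := exists_large_coord ha ha1 (by linarith) hδ hf' hg' hg hadd hsub
  have hn' : m ^ 2 ≤ |f n| := by
    have h0 := abs_nonneg (f n)
    nlinarith
  obtain ⟨s, hs⟩ := norm_sub_unit_rpow_le hm0 hm1.le (f := f) (n := n)
    ((mul_le_mul_of_nonneg_left hf hm0.le).trans hδm) hn'
  exact ⟨n, s, (Real.rpow_le_rpow_iff (norm_nonneg _) hη.le hp0).1 (hs.trans hm.le)⟩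

theorem abs_sign (s : ℤˣ) : |((s : ℤ) : ℝ)| = 1 := by
  rcases Int.units_eq_one_or s with rfl | rfl <;> simp

theorem norm_unit_add_unit_eq {i j : ℕ} (hij : i ≠ j) (s : ℤˣ) :
    ‖unit hp i + ((s : ℤ) : ℝ) • unit hp j‖ = ‖unit hp 0 + unit hp 1‖ := by
  obtain ⟨a, ha, -, hM⟩ := exists_expFun_eq hp (s := 1 / 2) (b := 1) (by norm_num) one_pos
    (by rw [expFun_one]; norm_num)
  rw [norm_unit_add_unit ha hM hij s]
  simpa using (norm_unit_add_unit (hp := hp) ha hM zero_ne_one 1).symm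

theorem one_le_norm_unit_add_unit {i j : ℕ} (hij : i ≠ j) (s : ℤˣ) :
    1 ≤ ‖unit hp i + ((s : ℤ) : ℝ) • unit hp j‖ := by
  refine le_trans (le_of_eq ?_) (abs_apply_le_norm _ i)
  rw [add_apply, smul_apply, unit_apply, unit_apply, if_pos rfl, if_neg hij, mul_zero, add_zero,
    abs_one]

variable (hp) in
/-- Almost isometric embeddings map unit vectors close to distinct signed unit vectors. -/
theorem exists_units_near {η : ℝ} (hη : 0 < η) (hη' : η < 1 / 4) : ∃ δ : ℝ, 0 < δ ∧ δ ≤ 1 ∧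
    ∀ {ι : Type} [Nontrivial ι] (e : ι → ℕ) (_ : Function.Injective e)
      {F : Submodule ℝ (ExpSeq p hp)} (h : ∀ i, unit hp (e i) ∈ F)
      (T : F →L[ℝ] ExpSeq p hp), T ∈ EmbC (1 + δ) F →
      ∃ (n : ι → ℕ) (s : ι → ℤˣ), Function.Injective n ∧
        ∀ i, ‖T ⟨unit hp (e i), h i⟩ - ((s i : ℤ) : ℝ) • unit hp (n i)‖ ≤ η := by
  obtain ⟨δ, hδ0, hδ1, hδ⟩ := exists_near_unit hp hη
  refine ⟨δ, hδ0, hδ1, fun {ι} _ e he F h T ⟨_, hT, hT'⟩ => ?_⟩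
  have hle : ∀ x : F, ‖T x‖ ≤ (1 + δ) * ‖(x : ExpSeq p hp)‖ := fun x =>
    (T.le_opNorm x).trans (mul_le_mul_of_nonneg_right hT (norm_nonneg _))
  have hex : ∀ i, ∃ (n : ℕ) (s : ℤˣ),
      ‖T ⟨unit hp (e i), h i⟩ - ((s : ℤ) : ℝ) • unit hp n‖ ≤ η := by
    intro i
    -- Rigidity is a statement about pairs, so each unit vector needs a partner.
    obtain ⟨j, hj⟩ := exists_ne i
    have hij : e i ≠ e j := fun h => hj (he h).symm
    have h1 := hle ⟨unit hp (e i), h i⟩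
    have h2 := hle ⟨unit hp (e j), h j⟩
    have h3 := hT' ⟨unit hp (e i), h i⟩
    have h4 := hT' ⟨unit hp (e j), h j⟩
    have h5 := hle (⟨unit hp (e i), h i⟩ + ⟨unit hp (e j), h j⟩)
    have h6 := hle (⟨unit hp (e i), h i⟩ - ⟨unit hp (e j), h j⟩)
    have n1 := norm_unit_add_unit_eq (hp := hp) hij 1
    have n2 := norm_unit_add_unit_eq (hp := hp) hij (-1)
    simp only [Units.val_one, Int.cast_one, one_smul, Units.val_neg, Int.cast_neg, neg_smul,
      ← sub_eq_add_neg] at n1 n2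
    simp only [Submodule.coe_norm, norm_unit, mul_one] at h1 h2 h3 h4
    rw [map_add, Submodule.coe_add, n1] at h5
    rw [map_sub, Submodule.coe_sub, n2] at h6
    exact hδ _ _ h1 h3 h2 h4 h5 h6
  choose n s hns using hex
  refine ⟨n, s, fun i j hij => ?_, hns⟩
  by_contra hne
  have hne' : e i ≠ e j := fun h => hne (he h)
  -- If `n i = n j`, this sign makes the two approximating vectors cancel: the image of `e_i + u
  -- e_j` has norm at most `2 * η < 1/2`, but it must be at least `1 / (1 + δ) ≥ 1/2`.
  set u : ℤˣ := -(s i * s j) with hu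
  have h1 := hT' (⟨unit hp (e i), h i⟩ + ((u : ℤ) : ℝ) • ⟨unit hp (e j), h j⟩)
  have h2 := one_le_norm_unit_add_unit (hp := hp) hne' u
  rw [map_add, map_smul, Submodule.coe_norm, Submodule.coe_add, Submodule.coe_smul] at h1
  have h3 : T ⟨unit hp (e i), h i⟩ + ((u : ℤ) : ℝ) • T ⟨unit hp (e j), h j⟩ =
      (T ⟨unit hp (e i), h i⟩ - ((s i : ℤ) : ℝ) • unit hp (n i)) +
      ((u : ℤ) : ℝ) • (T ⟨unit hp (e j), h j⟩ - ((s j : ℤ) : ℝ) • unit hp (n j)) := by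
    have h4 : (((u * s j : ℤˣ) : ℤ) : ℝ) = -((s i : ℤ) : ℝ) := by
      rw [hu, neg_mul, mul_assoc, Int.units_mul_self, mul_one, Units.val_neg, Int.cast_neg]
    rw [Units.val_mul, Int.cast_mul] at h4
    rw [smul_sub, smul_smul, h4, hij]
    module
  have h5 : ‖T ⟨unit hp (e i), h i⟩ + ((u : ℤ) : ℝ) • T ⟨unit hp (e j), h j⟩‖ ≤ η + η := by
    rw [h3]
    refine (norm_add_le _ _).trans (add_le_add (hns i) ?_)
    rw [norm_smul, Real.norm_eq_abs, abs_sign, one_mul]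
    exact hns j
  nlinarith

/-! ### The guarded Fraïssé property -/

theorem norm_apply_sub_sum_le {N : ℕ} {F : Submodule ℝ (ExpSeq p hp)} {T : F →L[ℝ] ExpSeq p hp}
    (hT : ‖T‖ ≤ 2) (h : ∀ i : Fin N, unit hp i ∈ F) {v : Fin N → ExpSeq p hp} {η : ℝ}
    (hv : ∀ i : Fin N, ‖T ⟨unit hp i, h i⟩ - v i‖ ≤ η) (x : F) :
    ‖T x - ∑ i : Fin N, x.1 i • v i‖ ≤
      2 * ‖x.1 - ∑ i : Fin N, x.1 i • unit hp i‖ + N * η * ‖x.1‖ := by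
  -- Split `x` into tail and head: `T` at most doubles the tail, and each of the `N` head terms
  -- costs at most `η * ‖x‖`.
  have e : T x - ∑ i : Fin N, x.1 i • v i = T (x - ∑ i : Fin N, x.1 i • ⟨unit hp i, h i⟩) +
      ∑ i : Fin N, x.1 i • (T ⟨unit hp i, h i⟩ - v i) := by
    simp only [map_sub, map_sum, map_smul, smul_sub, Finset.sum_sub_distrib]
    abel
  rw [e]
  refine (norm_add_le _ _).trans (add_le_add ?_ ?_)
  · refine (T.le_opNorm _).trans (mul_le_mul hT (le_of_eq ?_) (norm_nonneg _) zero_le_two)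
    rw [Submodule.coe_norm, Submodule.coe_sub, Submodule.coe_sum]
    rfl
  · refine (norm_sum_le _ _).trans ?_
    calc ∑ i : Fin N, ‖x.1 i • (T ⟨unit hp i, h i⟩ - v i)‖ ≤ ∑ _i : Fin N, ‖x.1‖ * η := by
          refine Finset.sum_le_sum fun i _ => ?_
          rw [norm_smul]
          exact mul_le_mul (abs_apply_le_norm _ _) (hv i) (norm_nonneg _) (norm_nonneg _)
      _ = N * η * ‖x.1‖ := by
          rw [Finset.sum_const, Finset.card_univ, Fintype.card_fin, nsmul_eq_mul]
          ring

/-- The tails tend to 0 on each vector of a finite basis, hence in operator norm on `E`. Requiring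
`2 ≤ N` provides the pairs that rigidity needs. -/
theorem exists_uniform_truncation (E : Submodule ℝ (ExpSeq p hp)) [FiniteDimensional ℝ E]
    {ε : ℝ} (hε : 0 < ε) : ∃ N : ℕ, 2 ≤ N ∧
      ∀ x ∈ E, ‖x - ∑ i : Fin N, x i • unit hp i‖ ≤ ε * ‖x‖ := by
  obtain ⟨C, hC, h⟩ := (Module.finBasis ℝ E).exists_opNorm_le (F := ExpSeq p hp)
  let R : ℕ → E →ₗ[ℝ] ExpSeq p hp := fun N =>
    (LinearMap.id - ∑ i ∈ Finset.range N, (coord p hp i).smulRight (unit hp i)).comp E.subtype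
  have hR : ∀ N x, R N x = x.1 - ∑ i ∈ Finset.range N, x.1 i • unit hp i := fun N x => by
    simp only [R, LinearMap.comp_apply, LinearMap.sub_apply, LinearMap.sum_apply,
      LinearMap.smulRight_apply]
    rfl
  have hlim : ∀ k, ∀ᶠ N in atTop, ‖R N (Module.finBasis ℝ E k)‖ ≤ ε / C := fun k => by
    have h1 := (hasSum_unit (Module.finBasis ℝ E k).1).tendsto_sum_nat
    have h2 := (tendsto_const_nhds (x := (Module.finBasis ℝ E k).1)).sub h1
    rw [sub_self] at h2
    refine (h2.norm.eventually_le_const (u := ε / C) ?_).mono fun N hN => ?_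
    · rw [norm_zero]
      positivity
    · rwa [hR]
  obtain ⟨N, hN, hN2⟩ := ((eventually_all.2 hlim).and (eventually_ge_atTop 2)).exists
  refine ⟨N, hN2, fun x hx => ?_⟩
  have h1 := h (u := LinearMap.toContinuousLinearMap (R N)) (by positivity) hN
  rw [mul_div_cancel₀ _ hC.ne'] at h1
  have h2 := (LinearMap.toContinuousLinearMap (R N)).le_of_opNorm_le h1 ⟨x, hx⟩
  rw [LinearMap.coe_toContinuousLinearMap', hR] at h2
  rwa [Fin.sum_univ_eq_sum_range fun i => x i • unit hp i]

theorem exists_signedPerm {N : ℕ} {m n : Fin N → ℕ} (hm : Function.Injective m)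
    (hn : Function.Injective n) (s t : Fin N → ℤˣ) : ∃ U : ExpSeq p hp ≃ₗᵢ[ℝ] ExpSeq p hp,
      ∀ i, U (((s i : ℤ) : ℝ) • unit hp (m i)) = ((t i : ℤ) : ℝ) • unit hp (n i) := by
  have := Equiv.Perm.isMultiplyPretransitive ℕ N
  -- The permutation goes from `n` to `m`, since `signedPerm` sends the unit vector at `σ k` to a
  -- signed unit vector at `k`.
  obtain ⟨σ, hσ⟩ := MulAction.exists_smul_eq (Equiv.Perm ℕ) (⟨n, hn⟩ : Fin N ↪ ℕ) ⟨m, hm⟩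
  have hσ' : ∀ i, σ (n i) = m i := fun i => DFunLike.congr_fun hσ i
  refine ⟨signedPerm hp σ (Function.extend n (fun i => s i * t i) 1), fun i => ?_⟩
  rw [← hσ', map_smul, signedPerm_unit, hn.extend_apply, smul_smul, ← Int.cast_mul,
    ← Units.val_mul, ← mul_assoc, Int.units_mul_self, one_mul]

theorem isGuardedFraisse : IsGuardedFraisse (ExpSeq p hp) := by
  intro E hE ε hε
  obtain ⟨N, hN2, hN⟩ := exists_uniform_truncation E (ε := ε / 8) (by positivity)
  have hN0 : 0 < N := by omega
  have hN' : (0 : ℝ) < N := Nat.cast_pos.2 hN0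
  -- Each of `T` and `S` contributes a tail error `2 * (ε / 8)` and a head error `N * η ≤ ε / 8`, in
  -- total `3 * ε / 4`. The bound `1 / 8` is for the rigidity lemma.
  set η : ℝ := min (1 / 8) (ε / (8 * N)) with hη
  have hη0 : 0 < η := lt_min (by norm_num) (by positivity)
  have hηN : N * η ≤ ε / 8 := by
    calc N * η ≤ N * (ε / (8 * N)) := by gcongr; exact min_le_right _ _
      _ = ε / 8 := by field_simp
  obtain ⟨δ, hδ0, hδ1, hδ⟩ := exists_units_near hp hη0
    ((min_le_left _ _).trans_lt (by norm_num : (1 / 8 : ℝ) < 1 / 4))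
  have : Nontrivial (Fin N) := Fin.nontrivial_iff_two_le.2 hN2
  have hF : ∀ i : Fin N, unit hp i ∈
      E ⊔ Submodule.span ℝ (Set.range fun i : Fin N => unit hp (i : ℕ)) := fun i =>
    Submodule.mem_sup_right (Submodule.subset_span ⟨i, rfl⟩)
  have : FiniteDimensional ℝ (Submodule.span ℝ (Set.range fun i : Fin N => unit hp (i : ℕ))) :=
    FiniteDimensional.span_of_finite ℝ (Set.finite_range _)
  refine ⟨δ, hδ0, E ⊔ Submodule.span ℝ (Set.range fun i : Fin N => unit hp (i : ℕ)),
    inferInstance, le_sup_left, ?_⟩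
  rintro _ ⟨T, hT, rfl⟩ _ ⟨S, hS, rfl⟩
  obtain ⟨m, s, hm, hms⟩ := hδ (fun i : Fin N => (i : ℕ)) Fin.val_injective hF T hT
  obtain ⟨n, t, hn, hnt⟩ := hδ (fun i : Fin N => (i : ℕ)) Fin.val_injective hF S hS
  obtain ⟨U, hU⟩ := exists_signedPerm (hp := hp) hm hn s t
  refine (Metric.infDist_le_dist_of_mem (MulAction.mem_orbit _ U)).trans ?_
  refine (dist_eq_norm (E := E →L[ℝ] ExpSeq p hp) _ _).trans_le ?_
  refine ContinuousLinearMap.opNorm_le_bound _ hε.le fun x => ?_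
  have hx := hN x x.2
  have h1 := norm_apply_sub_sum_le (hT.2.1.trans (by linarith)) hF
    (v := fun i => ((s i : ℤ) : ℝ) • unit hp (m i)) hms
    ⟨x, Submodule.mem_sup_left x.2⟩
  have h2 := norm_apply_sub_sum_le (hS.2.1.trans (by linarith)) hF
    (v := fun i => ((t i : ℤ) : ℝ) • unit hp (n i)) hnt
    ⟨x, Submodule.mem_sup_left x.2⟩
  have h3 : U (∑ i : Fin N, x.1 i • ((s i : ℤ) : ℝ) • unit hp (m i)) =
      ∑ i : Fin N, x.1 i • ((t i : ℤ) : ℝ) • unit hp (n i) := by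
    rw [map_sum]
    exact Finset.sum_congr rfl fun i _ => by rw [map_smul, hU]
  rw [← U.norm_map, map_sub, h3, norm_sub_rev] at h1
  have h4 := norm_sub_le_norm_sub_add_norm_sub (S ⟨x, Submodule.mem_sup_left x.2⟩)
    (∑ i : Fin N, x.1 i • ((t i : ℤ) : ℝ) • unit hp (n i))
    (U (T ⟨x, Submodule.mem_sup_left x.2⟩))
  have h5 : N * η * ‖x.1‖ ≤ ε / 8 * ‖x.1‖ := by gcongr
  change ‖S ⟨x, Submodule.mem_sup_left x.2⟩ - U (T ⟨x, Submodule.mem_sup_left x.2⟩)‖ ≤ ε * ‖x.1‖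
  have h6 : 0 ≤ ε * ‖x.1‖ := by positivity
  dsimp only at h1 h2
  linarith

/-! ### Flat vectors and failure of oligomorphicity -/

theorem half_le_norm_sub {k l : ℕ} (hl : 0 < l) (hkl : 2 * l ≤ k) {a b : ℝ} (ha : 0 < a)
    (hak : expFun p a = 1 / k) {n : Fin k → ℕ} (hn : Function.Injective n) (s : Fin k → ℤˣ) :
    1 / 2 ≤ ‖∑ i, a • ((s i : ℤ) : ℝ) • unit hp (n i) - ∑ i : Fin l, b • unit hp i‖ := by
  by_contra! hlt
  set y := ∑ i, a • ((s i : ℤ) : ℝ) • unit hp (n i) - ∑ i : Fin l, b • unit hp i with hy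
  have h1 := modular_le_norm (x := y) (by linarith)
  have hyi : ∀ m ∈ (Finset.univ.image n) \ Finset.range l, expFun p |y m| = 1 / k := by
    intro m hm
    rw [Finset.mem_sdiff, Finset.mem_image, Finset.mem_range, not_lt] at hm
    obtain ⟨⟨i, -, rfl⟩, hm⟩ := hm
    have h2 : (∑ i : Fin l, b • unit hp i) (n i) = 0 := by
      rw [sum_apply]
      refine Finset.sum_eq_zero fun j _ => ?_
      rw [smul_apply, unit_apply, if_neg (by have := j.2; omega), mul_zero]
    have h3 : (∑ i, a • ((s i : ℤ) : ℝ) • unit hp (n i)) (n i) = a * ((s i : ℤ) : ℝ) := by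
      rw [sum_apply, Finset.sum_eq_single i]
      · rw [smul_apply, smul_apply, unit_apply, if_pos rfl, mul_one]
      · intro j _ hj
        rw [smul_apply, smul_apply, unit_apply, if_neg fun h => hj (hn h).symm, mul_zero,
          mul_zero]
      · simp
    rw [hy, sub_apply, h2, h3, sub_zero, abs_mul, abs_sign, mul_one, abs_of_pos ha, hak]
  -- At least `k - l ≥ k / 2` of the positions `n i` avoid the second vector, and each contributes
  -- `1 / k` to the modular, which is at most the norm.
  have h2 : (((Finset.univ.image n) \ Finset.range l).card : ℝ) * (1 / k) ≤ modular p y := by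
    rw [← nsmul_eq_mul, ← Finset.sum_const, ← Finset.sum_congr rfl hyi]
    exact (summable_expFun hp y.summable).sum_le_tsum _ fun _ _ => expFun_nonneg (abs_nonneg _)
  have h3 : k ≤ ((Finset.univ.image n) \ Finset.range l).card + l := by
    have := Finset.card_le_card_sdiff_add_card (s := Finset.univ.image n) (t := Finset.range l)
    rwa [Finset.card_image_of_injective _ hn, Finset.card_univ, Fintype.card_fin,
      Finset.card_range] at this
  have h4 : (k : ℝ) ≤ 2 * ((Finset.univ.image n) \ Finset.range l).card := by
    exact_mod_cast (by omega : k ≤ 2 * ((Finset.univ.image n) \ Finset.range l).card)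
  have hk : (0 : ℝ) < k := Nat.cast_pos.2 (by omega)
  rw [mul_one_div, div_le_iff₀ hk] at h2
  nlinarith

theorem le_norm_isometry_sub {k l : ℕ} (hl : 0 < l) (hkl : 2 * l ≤ k) {a b : ℝ} (ha : 0 < a)
    (ha1 : a ≤ 1) (hak : expFun p a = 1 / k) (U : ExpSeq p hp ≃ₗᵢ[ℝ] ExpSeq p hp) :
    3 / 8 ≤ ‖U (∑ i : Fin k, a • unit hp i) - ∑ i : Fin l, b • unit hp i‖ := by
  have hk : (0 : ℝ) < k := Nat.cast_pos.2 (by omega)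
  have : Nontrivial (Fin k) := Fin.nontrivial_iff_two_le.2 (by omega)
  -- With this `η` the `k` errors add up to at most `1/8`, leaving `1/2 - 1/8 = 3/8`.
  obtain ⟨δ, hδ0, -, hδ⟩ := exists_units_near hp (η := 1 / (8 * k)) (by positivity) (by
    rw [div_lt_div_iff₀ (by positivity) (by norm_num)]
    have : (1 : ℝ) ≤ k := Nat.one_le_cast.2 (by omega)
    linarith)
  have hU : (U : ExpSeq p hp →L[ℝ] ExpSeq p hp).comp (⊤ : Submodule ℝ (ExpSeq p hp)).subtypeL ∈
      EmbC (1 + δ) ⊤ := by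
    refine ⟨U.injective.comp Subtype.val_injective,
      ContinuousLinearMap.opNorm_le_bound _ (by linarith) fun x => ?_, fun x => ?_⟩
    · change ‖U x‖ ≤ _ * ‖x.1‖
      rw [U.norm_map]
      nlinarith [norm_nonneg x.1]
    · change ‖x.1‖ ≤ _ * ‖U x‖
      rw [U.norm_map]
      nlinarith [norm_nonneg x.1]
  obtain ⟨n, s, hn, hns⟩ := hδ (fun i : Fin k => (i : ℕ)) Fin.val_injective
    (fun i => Submodule.mem_top) _ hU
  have h1 := half_le_norm_sub (b := b) hl hkl ha hak hn s (hp := hp)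
  have h2 : ‖U (∑ i : Fin k, a • unit hp i) - ∑ i, a • ((s i : ℤ) : ℝ) • unit hp (n i)‖ ≤
      1 / 8 := by
    simp only [map_sum, map_smul, ← Finset.sum_sub_distrib, ← smul_sub]
    refine (norm_sum_le _ _).trans ?_
    calc ∑ i : Fin k, ‖a • (U (unit hp i) - ((s i : ℤ) : ℝ) • unit hp (n i))‖
        ≤ ∑ _i : Fin k, 1 / (8 * (k : ℝ)) := by
          refine Finset.sum_le_sum fun i _ => ?_
          rw [norm_smul, Real.norm_of_nonneg ha.le]
          exact (mul_le_of_le_one_left (norm_nonneg _) ha1).trans (hns i)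
      _ = 1 / 8 := by
          rw [Finset.sum_const, Finset.card_univ, Fintype.card_fin, nsmul_eq_mul]
          field_simp
  have h3 := norm_sub_le_norm_sub_add_norm_sub (∑ i, a • ((s i : ℤ) : ℝ) • unit hp (n i))
    (U (∑ i : Fin k, a • unit hp i)) (∑ i : Fin l, b • unit hp i)
  rw [norm_sub_rev _ (U _)] at h3
  linarith

theorem modular_sum_fin_unit (k : ℕ) (a : ℝ) :
    modular p (∑ i : Fin k, a • unit hp i).1 = k * expFun p |a| := by
  rw [Fin.sum_univ_eq_sum_range fun i => a • unit hp i, modular_sum_unit _ fun _ => a,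
    Finset.sum_const, Finset.card_range, nsmul_eq_mul]

/-- The case `n = 1` already fails: normalized flat vectors on `2 ^ j` coordinates form a sequence
in the quotient with mutual distances at least `3/8`, so no subsequence is Cauchy. -/
theorem not_isOligomorphic : ¬ IsOligomorphic (ExpSeq p hp) := by
  intro h
  have hex : ∀ j : ℕ, ∃ a, 0 < a ∧ a ≤ 1 ∧ expFun p a = 1 / ((2 ^ j : ℕ) : ℝ) := fun j =>
    exists_expFun_eq hp (by positivity) one_pos (by
      rw [expFun_one, div_le_one (by positivity)]
      exact Nat.one_le_cast.2 Nat.one_le_two_pow)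
  choose a ha ha1 haM using hex
  let w : ℕ → ExpSeq p hp := fun j => ∑ i : Fin (2 ^ j), a j • unit hp i
  have hw : ∀ j, w j ∈ Metric.closedBall (0 : ExpSeq p hp) 1 := fun j => by
    rw [mem_closedBall_zero_iff]
    refine norm_le_one_iff.2 (le_of_eq ?_)
    rw [modular_sum_fin_unit, abs_of_pos (ha j), haM, mul_one_div_cancel]
    positivity
  let q : ℕ → MetricQuotient (ExpSeq p hp ≃ₗᵢ[ℝ] ExpSeq p hp)
      (Fin 1 → Metric.closedBall (0 : ExpSeq p hp) 1) := fun j =>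
    SeparationQuotient.mk (fun _ => ⟨w j, hw j⟩)
  have := h 1
  obtain ⟨z, φ, hφ, hz⟩ := CompactSpace.tendsto_subseq q
  obtain ⟨N, hN⟩ := Metric.cauchySeq_iff'.1 hz.cauchySeq (1 / 4) (by norm_num)
  have h1 := hN (N + 1) (by omega)
  have h2 : 3 / 8 ≤ dist ((q ∘ φ) (N + 1)) ((q ∘ φ) N) := by
    change 3 / 8 ≤ ⨅ U : ExpSeq p hp ≃ₗᵢ[ℝ] ExpSeq p hp, dist
      (U • (fun _ => ⟨w (φ (N + 1)), hw _⟩ : Fin 1 → Metric.closedBall (0 : ExpSeq p hp) 1))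
      (fun _ => ⟨w (φ N), hw _⟩)
    refine le_ciInf fun U => ?_
    refine le_trans ?_ (dist_le_pi_dist _ _ 0)
    change 3 / 8 ≤ dist (U (w (φ (N + 1)))) (w (φ N))
    rw [dist_eq_norm]
    refine le_norm_isometry_sub (by positivity) ?_ (ha _) (ha1 _) (haM _) U
    rw [← pow_succ']
    exact Nat.pow_le_pow_right two_pos (hφ (Nat.lt_succ_self N))
  linarith

end ExpSeq

/-! ## Hilbert space does not embed into `ℓ_p` for `p > 2` -/

section HilbertSpace

variable {q : ℝ≥0∞}

theorem sum_single_apply (s : Finset ℕ) (x : ℕ → ℝ) (m : ℕ) :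
    (∑ i ∈ s, lp.single (E := fun _ : ℕ => ℝ) q i (x i)) m = if m ∈ s then x m else 0 := by
  rw [lp.coeFn_sum, Finset.sum_apply]
  simp [lp.single_apply, Pi.single_apply]

variable [Fact (1 ≤ q)]

/-- A gliding hump: `s` is almost finitely supported and `f k` almost vanishes there for large `k`,
so the powers of the norms nearly add. The summand 1 absorbs the errors. -/
theorem norm_rpow_add_le_of_tendsto_zero (hq0 : 0 < q.toReal) (hq : q ≠ ∞)
    (s : lp (fun _ : ℕ => ℝ) q) {f : ℕ → lp (fun _ : ℕ => ℝ) q} {C : ℝ} (hC : ∀ k, ‖f k‖ ≤ C)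
    (hf : ∀ m, Tendsto (fun k => f k m) atTop (𝓝 0)) :
    ∀ᶠ k in atTop, ‖s + f k‖ ^ q.toReal ≤ ‖s‖ ^ q.toReal + C ^ q.toReal + 1 := by
  set r := q.toReal
  have hC0 : 0 ≤ C := (norm_nonneg _).trans (hC 0)
  set D := ‖s‖ ^ r + C ^ r with hD
  have hD0 : 0 ≤ D := by positivity
  -- The two copies of `ε` are for the tail of `s` and the head of `f k`.
  obtain ⟨ε, hε, hε0⟩ : ∃ ε : ℝ, (ε + ε + D ^ r⁻¹) ^ r < D + 1 ∧ 0 < ε := by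
    have hc : ContinuousAt (fun ε : ℝ => (ε + ε + D ^ r⁻¹) ^ r) 0 :=
      ContinuousAt.rpow_const (by fun_prop) (Or.inr hq0.le)
    have h := hc.tendsto
    simp only [add_zero, zero_add, Real.rpow_inv_rpow hD0 hq0.ne'] at h
    exact (((h.mono_left (nhdsWithin_le_nhds (s := Set.Ioi 0))).eventually
      (gt_mem_nhds (lt_add_one D))).and self_mem_nhdsWithin).exists
  let P : ℕ → lp (fun _ : ℕ => ℝ) q → lp (fun _ : ℕ => ℝ) q := fun n x =>
    ∑ i ∈ Finset.range n, lp.single q i (x i)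
  obtain ⟨n, hn⟩ : ∃ n, ‖s - P n s‖ ≤ ε := by
    have h1 := (tendsto_const_nhds (x := s)).sub (lp.hasSum_single hq s).tendsto_sum_nat
    rw [sub_self] at h1
    exact (h1.norm.eventually_le_const (by rwa [norm_zero])).exists
  have hP : ∀ᶠ k in atTop, ‖P n (f k)‖ ≤ ε := by
    have h1 : Tendsto (fun k => ∑ i ∈ Finset.range n, ‖f k i‖) atTop (𝓝 0) := by
      have := tendsto_finsetSum (Finset.range n) fun i _ => (hf i).norm
      simpa using this
    refine (h1.eventually_le_const hε0).mono fun k hk => le_trans ?_ hk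
    refine (norm_sum_le _ _).trans (le_of_eq (Finset.sum_congr rfl fun i _ => ?_))
    exact lp.norm_single (zero_lt_one.trans_le Fact.out) i _
  refine hP.mono fun k hk => ?_
  have h1 : ‖P n s + (f k - P n (f k))‖ ≤ D ^ r⁻¹ := by
    refine lp.norm_le_of_tsum_le hq0 (by positivity) ?_
    have hs := (lp.memℓp s).summable hq0
    have hk' := (lp.memℓp (f k)).summable hq0
    rw [Real.rpow_inv_rpow hD0 hq0.ne']
    calc ∑' i, ‖(P n s + (f k - P n (f k))) i‖ ^ r ≤ ∑' i, (‖s i‖ ^ r + ‖f k i‖ ^ r) := by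
          refine Summable.tsum_le_tsum (fun i => ?_) ((lp.memℓp _).summable hq0) (hs.add hk')
          rw [lp.coeFn_add, lp.coeFn_sub, Pi.add_apply, Pi.sub_apply, sum_single_apply,
            sum_single_apply]
          have n1 : 0 ≤ ‖s i‖ ^ r := by positivity
          have n2 : 0 ≤ ‖f k i‖ ^ r := by positivity
          split_ifs
          · rw [sub_self, add_zero]
            linarith
          · rw [sub_zero, zero_add]
            linarith
      _ = ‖s‖ ^ r + ‖f k‖ ^ r := by
          rw [hs.tsum_add hk', lp.norm_rpow_eq_tsum hq0, lp.norm_rpow_eq_tsum hq0]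
      _ ≤ D := by
          rw [hD]
          gcongr
          exact hC k
  have h2 : ‖s + f k‖ ≤ ε + ε + D ^ r⁻¹ := by
    have e : s + f k = (s - P n s) + P n (f k) + (P n s + (f k - P n (f k))) := by abel
    rw [e]
    exact (norm_add_le _ _).trans (add_le_add ((norm_add_le _ _).trans (add_le_add hn hk)) h1)
  exact (Real.rpow_le_rpow (norm_nonneg _) h2 hq0.le).trans hε.le

/-- By Riesz representation the values are the coordinates of a square-summable sequence. -/
theorem tendsto_apply_single_zero (g : lp (fun _ : ℕ => ℝ) 2 →L[ℝ] ℝ) :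
    Tendsto (fun k => g (lp.single 2 k 1)) atTop (𝓝 0) := by
  set v := (InnerProductSpace.toDual ℝ (lp (fun _ : ℕ => ℝ) 2)).symm g
  have hv : ∀ k, g (lp.single 2 k 1) = v k := fun k => by
    rw [← InnerProductSpace.toDual_symm_apply, lp.inner_single_right]
    simp [v]
  simp only [hv]
  have h := ((lp.memℓp v).summable (by norm_num)).tendsto_atTop_zero
  norm_num at h
  have h2 := h.sqrt
  simp only [Real.sqrt_sq_eq_abs, Real.sqrt_zero] at h2
  exact (tendsto_zero_iff_abs_tendsto_zero _).2 h2

/-- The images of the unit vectors are bounded and coordinatewise null, so greedily chosen sums of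
`N` of them have norm of order at most `N ^ (1 / r)`. The sums themselves have norm `N ^ (1 / 2)`,
and `r > 2`. -/
theorem not_boundedBelow_of_two_lt (hq2 : 2 < q.toReal) (hq : q ≠ ∞)
    (A : lp (fun _ : ℕ => ℝ) 2 →L[ℝ] lp (fun _ : ℕ => ℝ) q) {c : ℝ} (hc : 0 < c) :
    ¬ ∀ x, c * ‖x‖ ≤ ‖A x‖ := by
  intro hA
  set r := q.toReal with hr
  have hr0 : 0 < r := by linarith
  set K : ℝ := ‖A‖ ^ r + 1
  have hK : 0 < K := by positivity
  have hbound : ∀ k, ‖A (lp.single 2 k 1)‖ ≤ ‖A‖ := fun k => by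
    have := A.le_opNorm (lp.single 2 k 1)
    rwa [lp.norm_single two_pos, norm_one, mul_one] at this
  have hcoord : ∀ m, Tendsto (fun k => A (lp.single 2 k 1) m) atTop (𝓝 0) := fun m =>
    tendsto_apply_single_zero ((lp.evalCLM ℝ (fun _ : ℕ => ℝ) q m).comp A)
  have key : ∀ N : ℕ, ∃ S : Finset ℕ, S.card = N ∧
      ‖A (∑ k ∈ S, lp.single 2 k 1)‖ ^ r ≤ N * K := by
    intro N
    induction N with
    | zero => exact ⟨∅, rfl, by simp [hr0.ne']⟩
    | succ N ih =>
      obtain ⟨S, hS, hSN⟩ := ih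
      have h1 := norm_rpow_add_le_of_tendsto_zero hr0 hq (A (∑ k ∈ S, lp.single 2 k 1)) hbound
        hcoord
      have h2 : ∀ᶠ k in atTop, k ∉ S := by
        rw [← Nat.cofinite_eq_atTop]
        exact S.finite_toSet.eventually_cofinite_notMem
      obtain ⟨k, hk, hkS⟩ := (h1.and h2).exists
      refine ⟨insert k S, by rw [Finset.card_insert_of_notMem hkS, hS], ?_⟩
      rw [Finset.sum_insert hkS, add_comm, map_add]
      refine hk.trans ?_
      push_cast
      rw [add_mul, one_mul, add_assoc]
      exact add_le_add hSN le_rfl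
  have hle : ∀ N : ℕ, 0 < N → (N : ℝ) ^ (r / 2 - 1) ≤ K / c ^ r := by
    intro N hN
    have hN' : (0 : ℝ) < N := Nat.cast_pos.2 hN
    obtain ⟨S, hS, hSN⟩ := key N
    have h1 : ‖∑ k ∈ S, lp.single (E := fun _ : ℕ => ℝ) 2 k 1‖ = (N : ℝ) ^ (1 / 2 : ℝ) := by
      have h := lp.norm_sum_single (E := fun _ : ℕ => ℝ) (p := 2) (by norm_num) (fun _ => 1) S
      rw [← hS, ← Real.sqrt_eq_rpow]
      norm_num at h
      rw [← h, Real.sqrt_sq (norm_nonneg _)]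
    have h2 := hA (∑ k ∈ S, lp.single 2 k 1)
    rw [h1] at h2
    have h3 := (Real.rpow_le_rpow (by positivity) h2 hr0.le).trans hSN
    rw [Real.mul_rpow hc.le (by positivity), ← Real.rpow_mul hN'.le] at h3
    rw [le_div_iff₀ (by positivity), Real.rpow_sub_one hN'.ne', div_mul_eq_mul_div,
      div_le_iff₀ hN']
    calc (N : ℝ) ^ (r / 2) * c ^ r = c ^ r * (N : ℝ) ^ (1 / 2 * r) := by
          rw [mul_comm, show 1 / 2 * r = r / 2 by ring]
      _ ≤ N * K := h3
      _ = K * N := mul_comm _ _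
  have ht : Tendsto (fun N : ℕ => (N : ℝ) ^ (r / 2 - 1)) atTop atTop :=
    (tendsto_rpow_atTop (by linarith)).comp tendsto_natCast_atTop_atTop
  obtain ⟨N, hN, hN0⟩ := ((ht.eventually_gt_atTop (K / c ^ r)).and (eventually_gt_atTop 0)).exists
  exact absurd (hle N hN0) (not_le.2 hN)

end HilbertSpace

namespace ExpSeq

variable {p : ℝ} {hp : 3 < p}

theorem not_containsIsomorphicCopy :
    ¬ ContainsIsomorphicCopy (lp (fun _ : ℕ => ℝ) 2) (ExpSeq p hp) := by
  rintro ⟨Z, ⟨T⟩⟩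
  have := fact_one_le hp
  have hZ : ∀ z : Z, ‖z‖ ≤ ‖lpEquiv p hp z‖ := fun z => by
    have hp0 : 0 < p := by linarith
    refine (Real.rpow_le_rpow_iff (norm_nonneg _) (norm_nonneg _) hp0).1 ?_
    exact (norm_rpow_le z.1).trans_eq (norm_lpLinearEquiv_rpow z.1).symm
  refine not_boundedBelow_of_two_lt (q := ENNReal.ofReal p) ?_ ENNReal.ofReal_ne_top
    ((lpEquiv p hp : ExpSeq p hp →L[ℝ] _).comp (Z.subtypeL.comp (T : _ →L[ℝ] Z)))
    (c := (‖(T.symm : Z →L[ℝ] lp (fun _ : ℕ => ℝ) 2)‖ + 1)⁻¹) (by positivity) fun x => ?_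
  · rw [toReal_exponent hp]
    linarith
  · refine le_trans ?_ (hZ (T x))
    rw [inv_mul_le_iff₀ (by positivity)]
    have h := (T.symm : Z →L[ℝ] lp (fun _ : ℕ => ℝ) 2).le_opNorm (T x)
    rw [ContinuousLinearEquiv.coe_coe, ContinuousLinearEquiv.symm_apply_apply] at h
    nlinarith [norm_nonneg (T x)]

theorem not_containsIsometricCopy :
    ¬ ContainsIsometricCopy (lp (fun _ : ℕ => ℝ) 2) (ExpSeq p hp) :=
  fun ⟨Z, ⟨T⟩⟩ => not_containsIsomorphicCopy ⟨Z, ⟨T.toContinuousLinearEquiv⟩⟩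

end ExpSeq

/-! ## The `ℓ_p`-plane is a limit of planes of the sequence space, but does not embed into it -/

namespace ExpSeq

variable {p : ℝ} {hp : 3 < p}

theorem eq_one_of_rpow_eq_one (hp : 3 < p) {x : ℝ} (hx : 0 ≤ x) (h : x ^ p = 1) : x = 1 :=
  (Real.rpow_left_inj hx zero_le_one (by linarith : p ≠ 0)).1 (h.trans (Real.one_rpow p).symm)

theorem rpow_add_one_mul_exp_le (hp : 1 ≤ p) {s : ℝ} (hs : 0 ≤ s) (hs1 : s ≤ 1) :
    (1 + s) * Real.exp ((1 + s) ^ p⁻¹ - 1) ≤ 1 + 5 * s := by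
  have h1 : (1 + s) ^ p⁻¹ ≤ 1 + s := by
    refine (Real.rpow_le_rpow_of_exponent_le (by linarith) (inv_le_one_of_one_le₀ hp)).trans ?_
    rw [Real.rpow_one]
  have h2 : Real.exp ((1 + s) ^ p⁻¹ - 1) ≤ Real.exp s := Real.exp_le_exp.2 (by linarith)
  have h3 := (abs_le.1 (Real.abs_exp_sub_one_le (x := s) (by rwa [abs_of_nonneg hs]))).2
  rw [abs_of_nonneg hs] at h3
  nlinarith

/-- In the `ℓ_p`-plane the modulars of `f ± t g` are at most `1 + 5 * t ^ p`, whereas an overlap of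
the supports at `n` would raise their sum by a multiple of `t ^ 2`. -/
theorem disjoint_of_norm_rpow_eq {f g : ExpSeq p hp}
    (h : ∀ a b : ℝ, ‖a • f + b • g‖ ^ p = |a| ^ p + |b| ^ p) (n : ℕ) : f n = 0 ∨ g n = 0 := by
  have hp0 : 0 < p := by linarith
  have hf : ‖f‖ = 1 := by
    have := h 1 0
    rw [one_smul, zero_smul, add_zero, abs_one, abs_zero, Real.one_rpow, Real.zero_rpow hp0.ne',
      add_zero] at this
    exact eq_one_of_rpow_eq_one hp (norm_nonneg _) this
  have hmf := one_le_modular hf.ge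
  set κ := g n ^ 2 * expFun (p - 2) |f n| with hκ
  have key : ∀ t : ℝ, 0 < t → t ≤ 1 → κ ≤ 5 * t := by
    intro t ht ht1
    have hs0 : 0 ≤ t ^ p := by positivity
    have hs1 : t ^ p ≤ 1 := Real.rpow_le_one ht.le ht1 hp0.le
    set r := (1 + t ^ p) ^ p⁻¹ with hr
    have hr1 : 1 ≤ r := Real.one_le_rpow (by linarith) (by positivity)
    have hr0 : 0 < r := by linarith
    have hrp : r ^ p = 1 + t ^ p := Real.rpow_inv_rpow (by linarith) hp0.ne'
    have hmod : ∀ x : ExpSeq p hp, ‖x‖ ^ p = 1 + t ^ p → modular p x ≤ 1 + 5 * t ^ p := by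
      intro x hx
      have hxr : ‖x‖ = r := by
        rw [hr, ← hx, Real.rpow_rpow_inv (norm_nonneg _) hp0.ne']
      have h1 : ‖r⁻¹ • x‖ ≤ 1 := by
        rw [norm_smul, hxr, norm_inv, Real.norm_of_nonneg hr0.le, inv_mul_cancel₀ hr0.ne']
      have h2 := modular_smul_le hp (r⁻¹ • x).summable hr1 (B := 1) fun n =>
        (abs_apply_le_norm _ n).trans h1
      rw [coe_smul, smul_inv_smul₀ hr0.ne', mul_one, hrp] at h2
      refine h2.trans ((mul_le_of_le_one_right (by positivity) (norm_le_one_iff.1 h1)).trans ?_)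
      exact rpow_add_one_mul_exp_le (by linarith) hs0 hs1
    have h1 : modular p (f + t • g).1 ≤ 1 + 5 * t ^ p := hmod _ (by
      have := h 1 t
      rwa [one_smul, abs_one, Real.one_rpow, abs_of_pos ht] at this)
    have h2 : modular p (f - t • g).1 ≤ 1 + 5 * t ^ p := hmod _ (by
      have := h 1 (-t)
      rwa [one_smul, abs_one, Real.one_rpow, abs_neg, abs_of_pos ht, neg_smul,
        ← sub_eq_add_neg] at this)
    have h3 : 2 * (modular p f + t ^ 2 * κ) ≤
        modular p (f + t • g).1 + modular p (f - t • g).1 := by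
      have s0 := summable_expFun hp f.summable
      have s1 := summable_expFun hp (f + t • g).summable
      have s2 := summable_expFun hp (f - t • g).summable
      have s3 : HasSum (fun m => if m = n then t ^ 2 * κ else 0) (t ^ 2 * κ) :=
        hasSum_ite_eq n _
      rw [modular, modular, modular, ← s1.tsum_add s2, ← s3.tsum_eq, ← s0.tsum_add s3.summable,
        ← tsum_mul_left]
      refine Summable.tsum_le_tsum (fun m => ?_) ((s0.add s3.summable).mul_left 2) (s1.add s2)
      refine le_trans ?_ (parallelogram_expFun hp (f m) ((t • g) m))
      rw [expFun_eq_sq_mul hp (abs_nonneg (f m)), sq_abs, smul_apply]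
      have n1 : 0 ≤ expFun (p - 2) |f m| := expFun_nonneg (abs_nonneg _)
      split_ifs with hm
      · rw [hm, hκ]
        exact le_of_eq (by ring)
      · have : 0 ≤ (t * g m) ^ 2 * expFun (p - 2) |f m| := by positivity
        linarith
    -- Here `p > 3` makes the excess negligible against `t ^ 2`.
    have h4 : t ^ p ≤ t ^ 3 := by
      have := Real.rpow_le_rpow_of_exponent_ge ht ht1 hp.le
      rwa [← Nat.cast_ofNat, Real.rpow_natCast] at this
    have h5 : t ^ 2 * κ ≤ t ^ 2 * (5 * t) := by linarith
    exact le_of_mul_le_mul_left h5 (by positivity)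
  have hκ0 : κ ≤ 0 := by
    by_contra! hpos
    have h1 := key (min 1 (κ / 10)) (lt_min one_pos (by positivity)) (min_le_left _ _)
    have h2 := min_le_right 1 (κ / 10)
    linarith
  by_contra! hne
  have : 0 < κ := mul_pos (by have := hne.2; positivity) (expFun_pos (abs_pos.2 hne.1))
  linarith

/-- The supports are disjoint, so the modular is additive. With `a ^ p = 1/2` the vector `a f + a g`
should have norm 1, but contracting `f ≠ 0` by `a < 1` costs strictly more than the factor `a ^ p`,
so its modular is below 1. -/
theorem not_exists_norm_rpow_eq :
    ¬ ∃ f g : ExpSeq p hp, ∀ a b : ℝ, ‖a • f + b • g‖ ^ p = |a| ^ p + |b| ^ p := by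
  rintro ⟨f, g, h⟩
  have hp0 : 0 < p := by linarith
  have hd := disjoint_of_norm_rpow_eq h
  have hnorm : ∀ x : ExpSeq p hp, ‖x‖ ^ p = 1 → ‖x‖ = 1 := fun x hx =>
    eq_one_of_rpow_eq_one hp (norm_nonneg _) hx
  have hf : ‖f‖ = 1 := hnorm _ (by
    have := h 1 0
    rwa [one_smul, zero_smul, add_zero, abs_one, abs_zero, Real.one_rpow, Real.zero_rpow hp0.ne',
      add_zero] at this)
  have hg : ‖g‖ = 1 := hnorm _ (by
    have := h 0 1
    rwa [one_smul, zero_smul, zero_add, abs_one, abs_zero, Real.one_rpow, Real.zero_rpow hp0.ne',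
      zero_add] at this)
  set a : ℝ := (1 / 2) ^ p⁻¹ with ha
  have hap : a ^ p = 1 / 2 := Real.rpow_inv_rpow (by norm_num) hp0.ne'
  have ha0 : 0 < a := by positivity
  have ha1 : a < 1 := Real.rpow_lt_one (by norm_num) (by norm_num) (by positivity)
  have h1 : 1 ≤ modular p (a • f + a • g).1 := one_le_modular (hnorm _ (by
    rw [h, abs_of_pos ha0, hap]
    norm_num)).ge
  rw [modular_add_of_disjoint fun n => (hd n).imp (fun h => by rw [smul_apply, h, mul_zero])
    fun h => by rw [smul_apply, h, mul_zero], coe_smul, coe_smul] at h1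
  have h2 := modular_smul_le_smul hp g.summable ha0.le ha1.le
  have h3 : modular p (a • f.1) < a ^ p * modular p f := by
    obtain ⟨n, hn⟩ : ∃ n, f n ≠ 0 := by
      by_contra! h0
      rw [show f = 0 from ext h0, norm_zero] at hf
      exact zero_ne_one hf
    have e : ∀ m, expFun p |(a • f.1) m| =
        a ^ p * (Real.exp ((a - 1) * |f m|) * expFun p |f m|) := fun m => by
      rw [Pi.smul_apply, smul_eq_mul, abs_mul, abs_of_pos ha0, expFun_mul ha0.le (abs_nonneg _),
        mul_assoc]
    rw [modular, modular, ← tsum_mul_left]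
    refine Summable.tsum_lt_tsum (i := n) (fun m => ?_) ?_
      (summable_expFun hp (summable_rpow_smul a f.summable))
      ((summable_expFun hp f.summable).mul_left _)
    · rw [e]
      refine mul_le_mul_of_nonneg_left (mul_le_of_le_one_left (expFun_nonneg (abs_nonneg _)) ?_)
        (by positivity)
      exact Real.exp_le_one_iff.2 (mul_nonpos_of_nonpos_of_nonneg (by linarith) (abs_nonneg _))
    · rw [e]
      have hn' : 0 < |f n| := abs_pos.2 hn
      refine mul_lt_mul_of_pos_left (mul_lt_of_lt_one_left (expFun_pos hn') ?_) (by positivity)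
      exact Real.exp_lt_one_iff.2 (mul_neg_of_neg_of_pos (by linarith) hn')
  have h4 := norm_le_one_iff.1 hf.le
  have h5 := norm_le_one_iff.1 hg.le
  rw [hap] at h2 h3
  linarith

variable (hp) in
theorem exists_almost_lp_plane {θ : ℝ} (hθ : 0 < θ) : ∃ u v : ExpSeq p hp, ∀ a b : ℝ,
    |a| ^ p + |b| ^ p = 1 → Real.exp (-θ) ≤ ‖a • u + b • v‖ ∧ ‖a • u + b • v‖ ≤ 1 := by
  -- Blocks of `k + 1` coordinates of height `t ≤ θ` have modular 1, and multiplying one by `a`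
  -- gives modular `|a| ^ p * exp ((|a| - 1) * t)`. For `|a| ≤ 1` the exponent lies in `[-θ, 0]`.
  obtain ⟨k, hk⟩ := exists_nat_one_div_lt (expFun_pos (p := p) hθ)
  obtain ⟨t, ht, htθ, hMt⟩ := exists_expFun_eq hp (s := 1 / ((k : ℝ) + 1)) (by positivity) hθ hk.le
  have hblock : ∀ (s : Finset ℕ) (a : ℝ), s.card = k + 1 →
      modular p (a • ∑ i ∈ s, t • unit hp i).1 = |a| ^ p * Real.exp ((|a| - 1) * t) := by
    intro s a hs
    simp only [Finset.smul_sum, smul_smul]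
    rw [modular_sum_unit s fun _ => a * t, Finset.sum_const, hs, nsmul_eq_mul, abs_mul,
      abs_of_pos ht, expFun_mul (abs_nonneg a) ht.le, hMt]
    push_cast
    field_simp
  refine ⟨∑ i ∈ Finset.range (k + 1), t • unit hp i,
    ∑ i ∈ Finset.Ico (k + 1) (2 * (k + 1)), t • unit hp i, fun a b hab => ?_⟩
  have hm : modular p (a • ∑ i ∈ Finset.range (k + 1), t • unit hp i +
      b • ∑ i ∈ Finset.Ico (k + 1) (2 * (k + 1)), t • unit hp i).1 =
      |a| ^ p * Real.exp ((|a| - 1) * t) + |b| ^ p * Real.exp ((|b| - 1) * t) := by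
    rw [modular_add_of_disjoint, hblock _ _ (Finset.card_range _),
      hblock _ _ (by rw [Nat.card_Ico]; omega)]
    intro n
    rw [smul_apply, smul_apply, sum_unit_apply _ fun _ => t, sum_unit_apply _ fun _ => t]
    rcases lt_or_ge n (k + 1) with h | h
    · right
      rw [if_neg (by rw [Finset.mem_Ico]; omega), mul_zero]
    · left
      rw [if_neg (by rw [Finset.mem_range]; omega), mul_zero]
  have hp0 : 0 < p := by linarith
  have na : 0 ≤ |a| ^ p := by positivity
  have nb : 0 ≤ |b| ^ p := by positivity
  have hle : ∀ c : ℝ, |c| ^ p ≤ 1 → Real.exp ((|c| - 1) * t) ≤ 1 := fun c hc => by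
    have : |c| ≤ 1 := by
      by_contra! h
      exact absurd hc (not_le.2 (Real.one_lt_rpow h hp0))
    exact Real.exp_le_one_iff.2 (mul_nonpos_of_nonpos_of_nonneg (by linarith) ht.le)
  have hge : ∀ c : ℝ, Real.exp (-θ) ≤ Real.exp ((|c| - 1) * t) := fun c =>
    Real.exp_le_exp.2 (by nlinarith [mul_nonneg (abs_nonneg c) ht.le])
  have h1 : ‖a • ∑ i ∈ Finset.range (k + 1), t • unit hp i +
      b • ∑ i ∈ Finset.Ico (k + 1) (2 * (k + 1)), t • unit hp i‖ ≤ 1 := by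
    refine norm_le_one_iff.2 ?_
    rw [hm]
    have := mul_le_of_le_one_right na (hle a (by linarith))
    have := mul_le_of_le_one_right nb (hle b (by linarith))
    linarith
  refine ⟨le_trans ?_ (modular_le_norm h1), h1⟩
  rw [hm]
  have := mul_le_mul_of_nonneg_left (hge a) na
  have := mul_le_mul_of_nonneg_left (hge b) nb
  calc Real.exp (-θ) = |a| ^ p * Real.exp (-θ) + |b| ^ p * Real.exp (-θ) := by
        rw [← add_mul, hab, one_mul]
    _ ≤ _ := by linarith

/-! ### The `ℓ_p`-plane in the Banach–Mazur space -/

/-- The plane with the `ℓ_p`-norm. -/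
noncomputable def lpPlane (hp : 3 < p) : NormedSpaceOfDim 2 :=
  haveI := fact_one_le hp
  { carrier := PiLp (ENNReal.ofReal p) fun _ : Fin 2 => ℝ
    finrank_eq := by
      rw [(WithLp.linearEquiv (ENNReal.ofReal p) ℝ (Fin 2 → ℝ)).finrank_eq, Module.finrank_fin_fun] }

variable (hp) in
/-- Coordinates on the plane with the `ℓ_p`-norm. -/
noncomputable def lpPlaneEquiv : (ℝ × ℝ) ≃ₗ[ℝ] lpPlane hp :=
  (LinearEquiv.finTwoArrow ℝ ℝ).symm ≪≫ₗ (WithLp.linearEquiv (ENNReal.ofReal p) ℝ (Fin 2 → ℝ)).symm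

theorem norm_lpPlaneEquiv_rpow (a b : ℝ) : ‖lpPlaneEquiv hp (a, b)‖ ^ p = |a| ^ p + |b| ^ p := by
  have := fact_one_le hp
  have hp0 : 0 < p := by linarith
  have h := PiLp.norm_eq_sum (p := ENNReal.ofReal p) (β := fun _ : Fin 2 => ℝ)
    (by rw [toReal_exponent hp]; exact hp0) (WithLp.toLp _ ![a, b])
  rw [toReal_exponent hp, Fin.sum_univ_two] at h
  change ‖WithLp.toLp (ENNReal.ofReal p) ![a, b]‖ ^ p = _
  rw [h, one_div, Real.rpow_inv_rpow (by positivity) hp0.ne']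
  rfl

theorem lpPlane_not_mem_age : BM.mk (lpPlane hp) ∉ age (ExpSeq p hp) := by
  rintro ⟨n, E, hE, ⟨φ⟩⟩
  obtain rfl : 2 = n := congrArg Sigma.fst hE
  obtain ⟨ψ⟩ : Nonempty (lpPlane hp ≃ₗᵢ[ℝ] E) :=
    Quotient.exact (s := NormedSpaceOfDim.isometrySetoid 2) (eq_of_heq (Sigma.mk.inj hE).2)
  refine not_exists_norm_rpow_eq (hp := hp) ⟨φ (ψ (lpPlaneEquiv hp (1, 0))),
    φ (ψ (lpPlaneEquiv hp (0, 1))), fun a b => ?_⟩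
  have e : a • φ (ψ (lpPlaneEquiv hp (1, 0))) + b • φ (ψ (lpPlaneEquiv hp (0, 1))) =
      φ (ψ (lpPlaneEquiv hp (a, b))) := by
    rw [show ((a, b) : ℝ × ℝ) = a • (1, 0) + b • (0, 1) by simp]
    simp only [map_add, map_smul]
  rw [e, φ.norm_map, ψ.norm_map, norm_lpPlaneEquiv_rpow]

theorem exists_bmDist_lpPlane_le {θ : ℝ} (hθ : 0 < θ) : ∃ F : NormedSpaceOfDim 2,
    NormedSpaceOfDim.bmDist (lpPlane hp) F ≤ θ ∧ Nonempty (F →ₗᵢ[ℝ] ExpSeq p hp) := by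
  obtain ⟨u, v, huv⟩ := exists_almost_lp_plane hp hθ
  have hp0 : 0 < p := by linarith
  let T : lpPlane hp →ₗ[ℝ] ExpSeq p hp :=
    ((LinearMap.fst ℝ ℝ ℝ).smulRight u + (LinearMap.snd ℝ ℝ ℝ).smulRight v).comp
      (lpPlaneEquiv hp).symm.toLinearMap
  have hT1 : ∀ x, ‖x‖ = 1 → Real.exp (-θ) ≤ ‖T x‖ ∧ ‖T x‖ ≤ 1 := by
    intro x hx
    obtain ⟨⟨a, b⟩, rfl⟩ := (lpPlaneEquiv hp).surjective x
    have h := norm_lpPlaneEquiv_rpow (hp := hp) a b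
    rw [hx, Real.one_rpow] at h
    have e : T (lpPlaneEquiv hp (a, b)) = a • u + b • v := by
      simp [T]
    rw [e]
    exact huv a b h.symm
  have hT : ∀ x, Real.exp (-θ) * ‖x‖ ≤ ‖T x‖ ∧ ‖T x‖ ≤ ‖x‖ := by
    intro x
    rcases (norm_nonneg x).eq_or_lt with h0 | h0
    · rw [norm_eq_zero.1 h0.symm]
      simp
    · have h1 := hT1 (‖x‖⁻¹ • x) (by rw [norm_smul, norm_inv, norm_norm, inv_mul_cancel₀ h0.ne'])
      rw [map_smul, norm_smul, norm_inv, norm_norm, inv_mul_le_iff₀ h0, mul_one,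
        le_inv_mul_iff₀ h0, mul_comm] at h1
      exact h1
  have hinj : Function.Injective T := by
    refine (injective_iff_map_eq_zero T).2 fun x hx => ?_
    have h := (hT x).1
    rw [hx, norm_zero] at h
    exact norm_eq_zero.1 (le_antisymm
      (nonpos_of_mul_nonpos_right h (Real.exp_pos _)) (norm_nonneg x))
  let F : NormedSpaceOfDim 2 :=
    { carrier := LinearMap.range T
      finrank_eq := by rw [LinearMap.finrank_range_of_inj hinj, (lpPlane hp).finrank_eq] }
  let e : lpPlane hp ≃ₗ[ℝ] F := LinearEquiv.ofInjective T hinj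
  let S : lpPlane hp ≃L[ℝ] F := e.toContinuousLinearEquivOfBounds 1 (Real.exp θ)
    (fun x => by
      rw [one_mul]
      exact (hT x).2)
    (fun y => by
      obtain ⟨x, rfl⟩ := e.surjective y
      rw [LinearEquiv.symm_apply_apply]
      have h := (hT x).1
      rw [Real.exp_neg, inv_mul_le_iff₀ (Real.exp_pos _)] at h
      exact h)
  refine ⟨F, (ciInf_le (NormedSpaceOfDim.bddBelow_logDistortion _ _) S).trans ?_,
    ⟨(LinearMap.range T).subtypeₗᵢ⟩⟩
  have h1 : ‖(S : lpPlane hp →L[ℝ] F)‖ ≤ 1 :=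
    ContinuousLinearMap.opNorm_le_bound _ zero_le_one fun x => by
      rw [one_mul]
      exact (hT x).2
  have h2 : ‖(S.symm : F →L[ℝ] lpPlane hp)‖ ≤ Real.exp θ :=
    ContinuousLinearMap.opNorm_le_bound _ (Real.exp_pos _).le fun y => by
      obtain ⟨x, rfl⟩ := S.surjective y
      rw [ContinuousLinearEquiv.coe_coe, ContinuousLinearEquiv.symm_apply_apply]
      have h := (hT x).1
      rw [Real.exp_neg, inv_mul_le_iff₀ (Real.exp_pos _)] at h
      exact h
  have h3 := mul_le_mul h1 h2 (ContinuousLinearMap.opNorm_nonneg _) zero_le_one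
  rw [one_mul] at h3
  unfold NormedSpaceOfDim.logDistortion
  -- A zero product is harmless because `Real.log 0 = 0`.
  rcases (mul_nonneg (norm_nonneg (S : lpPlane hp →L[ℝ] F))
    (norm_nonneg (S.symm : F →L[ℝ] lpPlane hp))).eq_or_lt with h | h
  · rw [← h, Real.log_zero]
    exact hθ.le
  · exact (Real.log_le_iff_le_exp h).2 h3

/-- In the disjoint union topology it is enough to look inside `BMn 2`, where the `ℓ_p`-plane is a
limit of planes in the age. -/
theorem not_hasClosedAge : ¬ HasClosedAge (ExpSeq p hp) := by
  intro h
  have hc : IsClosed ((Sigma.mk 2 : BMn 2 → BM) ⁻¹' age (ExpSeq p hp)) :=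
    h.preimage continuous_sigmaMk
  refine lpPlane_not_mem_age (hp := hp) (hc.closure_subset (a :=
    (Quotient.mk (NormedSpaceOfDim.isometrySetoid 2) (lpPlane hp) : BMn 2))
    (Metric.mem_closure_iff.2 fun ε hε => ?_))
  obtain ⟨F, hF, hFX⟩ := exists_bmDist_lpPlane_le (hp := hp) (half_pos hε)
  exact ⟨Quotient.mk (NormedSpaceOfDim.isometrySetoid 2) F, ⟨2, F, rfl, hFX⟩,
    lt_of_le_of_lt hF (half_lt_self hε)⟩

end ExpSeq

theorem mainTheorem6 (p : ℝ) (hp : 3 < p) :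
    CompleteSpace (OrliczSeq (expOrlicz p hp)) ∧
    TopologicalSpace.SeparableSpace (OrliczSeq (expOrlicz p hp)) ∧
    IsGuardedFraisse (OrliczSeq (expOrlicz p hp)) ∧
    ¬ IsOligomorphic (OrliczSeq (expOrlicz p hp)) ∧
    ¬ ContainsIsometricCopy (lp (fun _ : ℕ => ℝ) 2) (OrliczSeq (expOrlicz p hp)) ∧
    ¬ ContainsIsomorphicCopy (lp (fun _ : ℕ => ℝ) 2) (OrliczSeq (expOrlicz p hp)) ∧
    ¬ HasClosedAge (OrliczSeq (expOrlicz p hp)) := by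
  exact ⟨ExpSeq.completeSpace, ExpSeq.separableSpace, ExpSeq.isGuardedFraisse,
    ExpSeq.not_isOligomorphic, ExpSeq.not_containsIsometricCopy,
    ExpSeq.not_containsIsomorphicCopy, ExpSeq.not_hasClosedAge⟩
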